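/- Throughout $g\in\mathbb N_0$, $j\wedge g=\min\{j,g\}$, and for $\underline\mu=(\mu_1,\dots,\mu_g)\in\mathbb C^g$ and $\underline E=(E_0,\dots,E_N)\in\mathbb C^{N+1}$ put $$\Psi_0(\underline\mu)=1,\qquad \Psi_k(\underline\mu)=(-1)^k\sum_{1\le\ell_1<\dots<\ell_k\le g}\mu_{\ell_1}\cdots\mu_{\ell_k}\quad(1\le k\le g),$$ $$c_k(\underline E)=\sum_{j_0+\dots+j_N=k}\frac{(2j_0-1)!!\cdots(2j_N-1)!!}{2^k\,j_0!\cdots j_N!}E_0^{j_0}\cdots E_N^{j_N}\quad(k\ge 0,\ (-1)!!=1).$$ All functions are complex-valued; functions of $x\in\mathbb R$ are $C^\infty$; a time variable, if present, is a fixed parameter and is suppressed. The recursions below are solved in differential (for Toda: difference) polynomials, i.e. polynomials in the given functions and their $x$-derivatives (respectively in the given sequences and their shifts); each integration (summation) is carried out so that the result has zero constant term, and then the integration constant, a number in $\mathbb C$, is added explicitly. A hat denotes the homogeneous coefficient, obtained by setting all integration constants $c_\ell$, $\ell\ge1$, equal to $0$. The letters $c_\ell$ without argument denote these constants. **(KdV)**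 Let $f_0=1$, $f_{j,x}=-\frac14f_{j-1,xxx}+Vf_{j-1,x}+\frac12V_xf_{j-1}$ for $j\ge1$, with integration constant $c_j$ in $f_j$, and $F_g(z,x)=\sum_{j=0}^gf_{g-j}(x)z^j$. Suppose $V$ is stationary, $f_{g+1,x}=0$, and let $E_0,\dots,E_{2g}$ be the zeros, with multiplicity, of the ($x$-independent, monic) polynomial $R_{2g+1}=\frac12F_{g,xx}F_g-\frac14F_{g,x}^2-(V-z)F_g^2$ in $z$. If $F_g(z,x)=\prod_{j=1}^g(z-\mu_j(x))$, then for all $j\in\mathbb N_0$ $$\hat f_j(x)=\sum_{k=0}^{j\wedge g}c_{j-k}(\underline E)\Psi_k(\underline\mu(x)).$$ **(Toda)** For sequences $a,b$ on $\mathbb Z$, with $f^\pm(n)=f(n\pm1)$, let $f_0=1$, $g_0=-c_1$, $2f_{j+1}+g_j+g_j^-+2bf_j=0$, $g_{j+1}-g_{j+1}^-+2(a^2f_j^+-(a^-)^2f_j^-)+b(g_j-g_j^-)=0$ for $j\ge0$, with summation constant $-c_{j+1}$ in $g_j$. Let $F_g=\sum_{j=0}^gf_{g-j}z^j$ and $G_{g+1}=-z^{g+1}+\sum_{j=0}^gg_{g-j}z^j+f_{g+1}$.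 Suppose $a,b$ are stationary, $g_g^++g_g+f_{g+1}^++f_{g+1}+2b^+f_g^+=0$ and $b(g_g+f_{g+1})+a^2f_g^+-(a^-)^2f_g^-+b^2f_g=0$ on $\mathbb Z$, and let $E_0,\dots,E_{2g+1}$ be the zeros, with multiplicity, of the ($n$-independent, monic) polynomial $R_{2g+2}=G_{g+1}^2-4a^2F_gF_g^+$. If $F_g(z,n)=\prod_{j=1}^g(z-\mu_j(n))$, then for all $j\in\mathbb N_0$ $$\hat f_j(n)=\sum_{k=0}^{j\wedge g}c_{j-k}(\underline E)\Psi_k(\underline\mu(n)).$$ **(AKNS)** Let $f_0=-iq$, $g_0=1$, $h_0=ip$, $g_{\ell+1,x}=pf_\ell+qh_\ell$ with integration constant $c_{\ell+1}$ in $g_{\ell+1}$, $f_{\ell+1}=\frac i2f_{\ell,x}-iqg_{\ell+1}$, $h_{\ell+1}=-\frac i2h_{\ell,x}+ipg_{\ell+1}$. Let $F_g=\sum_{\ell=0}^gf_{g-\ell}z^\ell$, $H_g=\sum_{\ell=0}^gh_{g-\ell}z^\ell$, $G_{g+1}=\sum_{\ell=0}^{g+1}g_{g+1-\ell}z^\ell$.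 Suppose $p,q$ are stationary, $f_{g+1}=h_{g+1}=0$, and let $E_0,\dots,E_{2g+1}$ be the zeros, with multiplicity, of the ($x$-independent, monic) polynomial $R_{2g+2}=G_{g+1}^2-F_gH_g$. If $F_g(z,x)=-iq(x)\prod_{j=1}^g(z-\mu_j(x))$, respectively $H_g(z,x)=ip(x)\prod_{j=1}^g(z-\nu_j(x))$, then for all $j\in\mathbb N_0$ $$\hat f_j(x)=-iq(x)\sum_{k=0}^{j\wedge g}c_{j-k}(\underline E)\Psi_k(\underline\mu(x)),\quad\text{respectively}\quad \hat h_j(x)=ip(x)\sum_{k=0}^{j\wedge g}c_{j-k}(\underline E)\Psi_k(\underline\nu(x)).$$ **(sGmKdV)** Let $\alpha,\beta\in\mathbb C$ and $w_\pm=-\frac14(u_x^2\pm2iu_{xx})$. For $0\le j\le g-1$ let $f_j$ and $h_j$ be the KdV coefficients of the potentials $w_+$ and $w_-$, respectively, with the same integration constants, and let $f_g=\hat f_g=\alpha e^{-iu}$, $h_g=\hat h_g=\beta e^{iu}$. Let $g_{-1}=0$ and $g_j=\frac i2(f_{j,x}+iu_xf_j)$ for $0\le j\le g-1$, and put $F_g=\sum_{j=0}^gf_{g-j}z^j$,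 $H_g=\sum_{j=0}^gh_{g-j}z^j$, $G_{g-1}=\sum_{j=0}^{g-1}g_{g-1-j}z^j$. Suppose $u$ is stationary, $2ig_{g-1,x}+2(\beta e^{iu}-\alpha e^{-iu})=0$, and let $E_0,\dots,E_{2g}$ be the zeros, with multiplicity, of the ($x$-independent) polynomial $R_{2g+1}=z^2G_{g-1}^2+zF_gH_g$, taken to be monic of degree $2g+1$. If $F_g(z,x)=\prod_{j=1}^g(z-\mu_j(x))$, respectively $H_g(z,x)=\prod_{j=1}^g(z-\nu_j(x))$, then for $j=0,\dots,g-1$ $$\hat f_j(x)=\sum_{k=0}^{j}c_{j-k}(\underline E)\Psi_k(\underline\mu(x)),\quad\text{respectively}\quad \hat h_j(x)=\sum_{k=0}^{j}c_{j-k}(\underline E)\Psi_k(\underline\nu(x)),$$ and $\hat f_g(x)=\Psi_g(\underline\mu(x))$, respectively $\hat h_g(x)=\Psi_g(\underline\nu(x))$. -/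

import Mathlib

open scoped ContDiff

noncomputable section

namespace Soliton

/-! ### Symmetric functions -/

/-- `Ψ_k(μ) = (-1)^k ∑_{ℓ_1 < ⋯ < ℓ_k} μ_{ℓ_1} ⋯ μ_{ℓ_k}`. -/
def Psi {g : ℕ} (k : ℕ) (μ : Fin g → ℂ) : ℂ :=
  (-1) ^ k * ∑ s ∈ Finset.powersetCard k (Finset.univ : Finset (Fin g)), ∏ l ∈ s, μ l

/-- `c_k(E) = ∑_{j_0 + ⋯ + j_N = k} (∏_m (2 j_m - 1)!! E_m^{j_m} / j_m!) / 2^k`, where `M = N + 1`.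
For `j_m = 0` the truncated `2 * j m - 1` is `0` and `0!! = 1`, as is `(-1)!!`. -/
def cCoeff {M : ℕ} (k : ℕ) (E : Fin M → ℂ) : ℂ :=
  ∑ j ∈ Finset.piAntidiag (Finset.univ : Finset (Fin M)) k,
    (∏ m, ((Nat.doubleFactorial (2 * j m - 1) : ℕ) : ℂ) / ((Nat.factorial (j m) : ℕ) : ℂ)
      * E m ^ j m) / 2 ^ k

/-- The monic polynomial in `z` with zeros `E_m`, listed with multiplicity. -/
def rootPoly {M : ℕ} (E : Fin M → ℂ) : Polynomial ℂ :=
  ∏ m, (Polynomial.X - Polynomial.C (E m))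

/-- `∑_{j=0}^{n-1} a_{n-1-j} z^j`. -/
def zPoly (n : ℕ) (a : ℕ → ℂ) : Polynomial ℂ :=
  ∑ j ∈ Finset.range n, Polynomial.C (a (n - 1 - j)) * Polynomial.X ^ j

/-! ### Differential and difference polynomials, integration constants -/

/-- Differential polynomials in unknown functions `u_i`; the variable `(i, k)` is the `k`-th
`x`-derivative of `u_i`. -/
abbrev DiffPoly (ι : Type) : Type := MvPolynomial (ι × ℕ) ℂ

/-- The `x`-derivative `∂` of differential polynomials. -/
def dx (ι : Type) : DiffPoly ι →ₗ[ℂ] DiffPoly ι :=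
  (MvPolynomial.mkDerivation ℂ
    (fun v : ι × ℕ => (MvPolynomial.X (v.1, v.2 + 1) : DiffPoly ι))).toLinearMap

/-- The value at `x` of a differential polynomial in the functions `u`. -/
def DiffPoly.at {ι : Type} (u : ι → ℝ → ℂ) (P : DiffPoly ι) (x : ℝ) : ℂ :=
  MvPolynomial.eval (fun v : ι × ℕ => iteratedDeriv v.2 (u v.1) x) P

/-- Difference polynomials in unknown sequences `u_i` on `ℤ`; the variable `(i, k)` is
`n ↦ u_i (n + k)`. -/
abbrev DiffcePoly (ι : Type) : Type := MvPolynomial (ι × ℤ) ℂ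

/-- The shift by `s`, `(S^s f)(n) = f (n + s)`. -/
def shift {ι : Type} (s : ℤ) : DiffcePoly ι →ₐ[ℂ] DiffcePoly ι :=
  MvPolynomial.rename (fun v : ι × ℤ => (v.1, v.2 + s))

/-- The backward difference `f ↦ f - f^-`. -/
def bdiff (ι : Type) : DiffcePoly ι →ₗ[ℂ] DiffcePoly ι :=
  LinearMap.id - (shift (-1)).toLinearMap

/-- The value at `n` of a difference polynomial in the sequences `u`. -/
def DiffcePoly.at {ι : Type} (u : ι → ℤ → ℂ) (P : DiffcePoly ι) (n : ℤ) : ℂ :=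
  MvPolynomial.eval (fun v : ι × ℤ => u v.1 (n + v.2)) P

open Classical in
/-- The solution `Q` of `T Q = P` whose constant term (its integration constant) vanishes. It is
used for `T = ∂` and for the backward difference, whose kernels consist of the constants, so that
such a `Q` is unique. (The value is `0` if there is no solution.) -/
def integral {σ : Type} (T : MvPolynomial σ ℂ →ₗ[ℂ] MvPolynomial σ ℂ) (P : MvPolynomial σ ℂ) :
    MvPolynomial σ ℂ :=
  if h : ∃ Q, MvPolynomial.constantCoeff Q = 0 ∧ T Q = P then h.choose else 0

/-! ### The KdV hierarchy -/

namespace KdV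

/-- The differential polynomial `V`. -/
def V : DiffPoly (Fin 1) := MvPolynomial.X (0, 0)

/-- `f_0 = 1`, `f_{j,x} = -(1/4) f_{j-1,xxx} + V f_{j-1,x} + (1/2) V_x f_{j-1}`, with integration
constants `c_j`, `j ≥ 1`. -/
def f (c : ℕ → ℂ) : ℕ → DiffPoly (Fin 1)
  | 0 => 1
  | j + 1 =>
    integral (dx (Fin 1))
      (MvPolynomial.C (-1 / 4) * dx _ (dx _ (dx _ (f c j))) + V * dx _ (f c j)
        + MvPolynomial.C (1 / 2) * dx _ V * f c j)
      + MvPolynomial.C (c (j + 1))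

/-- The function `f_j(x)` of a potential `W`. -/
def fAt (W : ℝ → ℂ) (c : ℕ → ℂ) (j : ℕ) : ℝ → ℂ := DiffPoly.at (fun _ => W) (f c j)

/-- The homogeneous coefficient: all integration constants vanish. -/
def fHat (W : ℝ → ℂ) (j : ℕ) : ℝ → ℂ := fAt W 0 j

/-- The stationary `g`-th KdV equation `f_{g+1,x} = 0`. -/
def IsStationary (W : ℝ → ℂ) (c : ℕ → ℂ) (g : ℕ) : Prop :=
  ∀ x, deriv (fAt W c (g + 1)) x = 0

/-- `F_g(z, x)` as a polynomial in `z`. -/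
def F (W : ℝ → ℂ) (c : ℕ → ℂ) (g : ℕ) (x : ℝ) : Polynomial ℂ :=
  zPoly (g + 1) (fun j => fAt W c j x)

/-- `F_{g,x}(z, x)`. -/
def Fx (W : ℝ → ℂ) (c : ℕ → ℂ) (g : ℕ) (x : ℝ) : Polynomial ℂ :=
  zPoly (g + 1) (fun j => deriv (fAt W c j) x)

/-- `F_{g,xx}(z, x)`. -/
def Fxx (W : ℝ → ℂ) (c : ℕ → ℂ) (g : ℕ) (x : ℝ) : Polynomial ℂ :=
  zPoly (g + 1) (fun j => deriv (deriv (fAt W c j)) x)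

/-- `R_{2g+1} = (1/2) F_{g,xx} F_g - (1/4) F_{g,x}^2 - (V - z) F_g^2`. -/
def R (W : ℝ → ℂ) (c : ℕ → ℂ) (g : ℕ) (x : ℝ) : Polynomial ℂ :=
  Polynomial.C (1 / 2) * Fxx W c g x * F W c g x - Polynomial.C (1 / 4) * Fx W c g x ^ 2
    - (Polynomial.C (W x) - Polynomial.X) * F W c g x ^ 2

end KdV

/-! ### The Toda hierarchy -/

namespace Toda

/-- The difference polynomial `a`. -/
def a : DiffcePoly (Fin 2) := MvPolynomial.X (0, 0)

/-- The difference polynomial `b`. -/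
def b : DiffcePoly (Fin 2) := MvPolynomial.X (1, 0)

/-- The pair `(f_j, g_j)`: `f_0 = 1`, `g_0 = -c_1`, `2 f_{j+1} + g_j + g_j^- + 2 b f_j = 0`,
`g_{j+1} - g_{j+1}^- + 2 (a^2 f_j^+ - (a^-)^2 f_j^-) + b (g_j - g_j^-) = 0`; the summation constant
in `g_j` is `-c_{j+1}`. -/
def fg (c : ℕ → ℂ) : ℕ → DiffcePoly (Fin 2) × DiffcePoly (Fin 2)
  | 0 => (1, MvPolynomial.C (-c 1))
  | j + 1 =>
    (-(MvPolynomial.C (1 / 2) * ((fg c j).2 + shift (-1) (fg c j).2)) - b * (fg c j).1,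
      integral (bdiff (Fin 2))
        (-(2 * (a ^ 2 * shift 1 (fg c j).1 - shift (-1) a ^ 2 * shift (-1) (fg c j).1))
          - b * ((fg c j).2 - shift (-1) (fg c j).2))
        - MvPolynomial.C (c (j + 2)))

/-- The sequence `f_j(n)`. -/
def fAt (a b : ℤ → ℂ) (c : ℕ → ℂ) (j : ℕ) : ℤ → ℂ := DiffcePoly.at ![a, b] (fg c j).1

/-- The sequence `g_j(n)`. -/
def gAt (a b : ℤ → ℂ) (c : ℕ → ℂ) (j : ℕ) : ℤ → ℂ := DiffcePoly.at ![a, b] (fg c j).2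

/-- The homogeneous coefficient: all summation constants vanish. -/
def fHat (a b : ℤ → ℂ) (j : ℕ) : ℤ → ℂ := fAt a b 0 j

/-- The stationary `g`-th Toda equations. -/
def IsStationary (a b : ℤ → ℂ) (c : ℕ → ℂ) (g : ℕ) : Prop :=
  ∀ n,
    gAt a b c g (n + 1) + gAt a b c g n + fAt a b c (g + 1) (n + 1) + fAt a b c (g + 1) n
        + 2 * b (n + 1) * fAt a b c g (n + 1) = 0 ∧
    b n * (gAt a b c g n + fAt a b c (g + 1) n) + a n ^ 2 * fAt a b c g (n + 1)
        - a (n - 1) ^ 2 * fAt a b c g (n - 1) + b n ^ 2 * fAt a b c g n = 0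

/-- `F_g(z, n)` as a polynomial in `z`. -/
def F (a b : ℤ → ℂ) (c : ℕ → ℂ) (g : ℕ) (n : ℤ) : Polynomial ℂ :=
  zPoly (g + 1) (fun j => fAt a b c j n)

/-- `G_{g+1}(z, n) = -z^{g+1} + ∑_{j=0}^g z^j g_{g-j}(n) + f_{g+1}(n)`. -/
def G (a b : ℤ → ℂ) (c : ℕ → ℂ) (g : ℕ) (n : ℤ) : Polynomial ℂ :=
  -Polynomial.X ^ (g + 1) + zPoly (g + 1) (fun j => gAt a b c j n)
    + Polynomial.C (fAt a b c (g + 1) n)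

/-- `R_{2g+2} = G_{g+1}^2 - 4 a^2 F_g F_g^+`. -/
def R (a b : ℤ → ℂ) (c : ℕ → ℂ) (g : ℕ) (n : ℤ) : Polynomial ℂ :=
  G a b c g n ^ 2 - Polynomial.C (4 * a n ^ 2) * F a b c g n * F a b c g (n + 1)

end Toda

/-! ### The AKNS hierarchy -/

namespace AKNS

open Complex (I)

/-- The differential polynomial `p`. -/
def p : DiffPoly (Fin 2) := MvPolynomial.X (0, 0)

/-- The differential polynomial `q`. -/
def q : DiffPoly (Fin 2) := MvPolynomial.X (1, 0)

/-- `g_{l+1}` from `f_l` and `h_l`: `g_{l+1,x} = p f_l + q h_l`, with integration constant `k`. -/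
def gNext (k : ℂ) (f h : DiffPoly (Fin 2)) : DiffPoly (Fin 2) :=
  integral (dx (Fin 2)) (p * f + q * h) + MvPolynomial.C k

/-- The pair `(f_l, h_l)`: `f_0 = -i q`, `h_0 = i p`, `f_{l+1} = (i/2) f_{l,x} - i q g_{l+1}`,
`h_{l+1} = -(i/2) h_{l,x} + i p g_{l+1}`, where `g_{l+1}` has integration constant `c_{l+1}`. -/
def fh (c : ℕ → ℂ) : ℕ → DiffPoly (Fin 2) × DiffPoly (Fin 2)
  | 0 => (MvPolynomial.C (-I) * q, MvPolynomial.C I * p)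
  | l + 1 =>
    (MvPolynomial.C (I / 2) * dx _ (fh c l).1
        - MvPolynomial.C I * q * gNext (c (l + 1)) (fh c l).1 (fh c l).2,
      MvPolynomial.C (-I / 2) * dx _ (fh c l).2
        + MvPolynomial.C I * p * gNext (c (l + 1)) (fh c l).1 (fh c l).2)

/-- `g_0 = 1`, `g_{l+1,x} = p f_l + q h_l`. -/
def gPoly (c : ℕ → ℂ) : ℕ → DiffPoly (Fin 2)
  | 0 => 1
  | l + 1 => gNext (c (l + 1)) (fh c l).1 (fh c l).2

/-- The function `f_l(x)`. -/
def fAt (p q : ℝ → ℂ) (c : ℕ → ℂ) (l : ℕ) : ℝ → ℂ := DiffPoly.at ![p, q] (fh c l).1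

/-- The function `h_l(x)`. -/
def hAt (p q : ℝ → ℂ) (c : ℕ → ℂ) (l : ℕ) : ℝ → ℂ := DiffPoly.at ![p, q] (fh c l).2

/-- The function `g_l(x)`. -/
def gAt (p q : ℝ → ℂ) (c : ℕ → ℂ) (l : ℕ) : ℝ → ℂ := DiffPoly.at ![p, q] (gPoly c l)

/-- The homogeneous coefficient of `f`: all integration constants vanish. -/
def fHat (p q : ℝ → ℂ) (l : ℕ) : ℝ → ℂ := fAt p q 0 l

/-- The homogeneous coefficient of `h`: all integration constants vanish. -/
def hHat (p q : ℝ → ℂ) (l : ℕ) : ℝ → ℂ := hAt p q 0 l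

/-- The stationary `g`-th AKNS equations `f_{g+1} = h_{g+1} = 0`. -/
def IsStationary (p q : ℝ → ℂ) (c : ℕ → ℂ) (g : ℕ) : Prop :=
  ∀ x, fAt p q c (g + 1) x = 0 ∧ hAt p q c (g + 1) x = 0

/-- `F_g(z, x)` as a polynomial in `z`. -/
def F (p q : ℝ → ℂ) (c : ℕ → ℂ) (g : ℕ) (x : ℝ) : Polynomial ℂ :=
  zPoly (g + 1) (fun l => fAt p q c l x)

/-- `G_{g+1}(z, x)` as a polynomial in `z`. -/
def G (p q : ℝ → ℂ) (c : ℕ → ℂ) (g : ℕ) (x : ℝ) : Polynomial ℂ :=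
  zPoly (g + 2) (fun l => gAt p q c l x)

/-- `H_g(z, x)` as a polynomial in `z`. -/
def H (p q : ℝ → ℂ) (c : ℕ → ℂ) (g : ℕ) (x : ℝ) : Polynomial ℂ :=
  zPoly (g + 1) (fun l => hAt p q c l x)

/-- `R_{2g+2} = G_{g+1}^2 - F_g H_g`. -/
def R (p q : ℝ → ℂ) (c : ℕ → ℂ) (g : ℕ) (x : ℝ) : Polynomial ℂ :=
  G p q c g x ^ 2 - F p q c g x * H p q c g x

end AKNS

/-! ### The sGmKdV hierarchy -/

namespace SGmKdV

open Complex (I)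

/-- `w_+ = -(1/4) (u_x^2 + 2 i u_xx)`. -/
def wPlus (u : ℝ → ℂ) (x : ℝ) : ℂ := -(1 / 4) * (deriv u x ^ 2 + 2 * I * deriv (deriv u) x)

/-- `w_- = -(1/4) (u_x^2 - 2 i u_xx)`. -/
def wMinus (u : ℝ → ℂ) (x : ℝ) : ℂ := -(1 / 4) * (deriv u x ^ 2 - 2 * I * deriv (deriv u) x)

/-- `f_j` for `j ≤ g`: the KdV coefficient of the potential `w_+` if `j < g`, and
`f_g = α e^{-iu}`. -/
def fAt (u : ℝ → ℂ) (α : ℂ) (g : ℕ) (c : ℕ → ℂ) (j : ℕ) (x : ℝ) : ℂ :=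
  if j = g then α * Complex.exp (-I * u x) else KdV.fAt (wPlus u) c j x

/-- `h_j` for `j ≤ g`: the KdV coefficient of the potential `w_-` if `j < g`, and
`h_g = β e^{iu}`. -/
def hAt (u : ℝ → ℂ) (β : ℂ) (g : ℕ) (c : ℕ → ℂ) (j : ℕ) (x : ℝ) : ℂ :=
  if j = g then β * Complex.exp (I * u x) else KdV.fAt (wMinus u) c j x

/-- `f̂_j`: all integration constants vanish. -/
def fHat (u : ℝ → ℂ) (α : ℂ) (g : ℕ) (j : ℕ) : ℝ → ℂ := fAt u α g 0 j

/-- `ĥ_j`: all integration constants vanish. -/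
def hHat (u : ℝ → ℂ) (β : ℂ) (g : ℕ) (j : ℕ) : ℝ → ℂ := hAt u β g 0 j

/-- `g_j = (i/2) (f_{j,x} + i u_x f_j)`, used for `0 ≤ j ≤ g - 1`. -/
def gAt (u : ℝ → ℂ) (α : ℂ) (g : ℕ) (c : ℕ → ℂ) (j : ℕ) (x : ℝ) : ℂ :=
  I / 2 * (deriv (fAt u α g c j) x + I * deriv u x * fAt u α g c j x)

/-- `g_{g-1}`, with `g_{-1} = 0`. -/
def gLast (u : ℝ → ℂ) (α : ℂ) (g : ℕ) (c : ℕ → ℂ) : ℝ → ℂ :=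
  if g = 0 then 0 else gAt u α g c (g - 1)

/-- The stationary `g`-th sGmKdV equation
`2 i g_{g-1,x} + 2 (β e^{iu} - α e^{-iu}) = 0`. -/
def IsStationary (u : ℝ → ℂ) (α β : ℂ) (c : ℕ → ℂ) (g : ℕ) : Prop :=
  ∀ x, 2 * I * deriv (gLast u α g c) x
    + 2 * (β * Complex.exp (I * u x) - α * Complex.exp (-I * u x)) = 0

/-- `F_g(z, x)` as a polynomial in `z`. -/
def F (u : ℝ → ℂ) (α : ℂ) (c : ℕ → ℂ) (g : ℕ) (x : ℝ) : Polynomial ℂ :=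
  zPoly (g + 1) (fun j => fAt u α g c j x)

/-- `H_g(z, x)` as a polynomial in `z`. -/
def H (u : ℝ → ℂ) (β : ℂ) (c : ℕ → ℂ) (g : ℕ) (x : ℝ) : Polynomial ℂ :=
  zPoly (g + 1) (fun j => hAt u β g c j x)

/-- `G_{g-1}(z, x)` as a polynomial in `z`; `G_{-1} = 0`. -/
def G (u : ℝ → ℂ) (α : ℂ) (c : ℕ → ℂ) (g : ℕ) (x : ℝ) : Polynomial ℂ :=
  zPoly g (fun j => gAt u α g c j x)

/-- `R_{2g+1} = z^2 G_{g-1}^2 + z F_g H_g`. -/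
def R (u : ℝ → ℂ) (α β : ℂ) (c : ℕ → ℂ) (g : ℕ) (x : ℝ) : Polynomial ℂ :=
  Polynomial.X ^ 2 * G u α c g x ^ 2 + Polynomial.X * F u α c g x * H u β c g x

end SGmKdV

end Soliton

end

/-! Put ζ = 1/z and collect the coefficients into power series in ζ. Each linear recursion has a
quadratic first integral. For KdV the derivative of `kdvForm` is 2Φ(Φ' - ζ · `kdvOp`), so a series Φ
with leading coefficient 1 obeys the recursion exactly when its form is constant in x. For AKNS the
integral is G² - ζ²FH, for Toda G² - 4ζ²a²FF⁺. Prescribing the value 1 for the integral, together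
with the leading coefficient, determines the series: once the leading term is split off, the
equations are a fixed-point problem whose right side improves agreement by one order in ζ
(`IsContraction`).

The solution with value 1 generates the homogeneous coefficients (the lemmas `exists_hat`). It
solves the recursion, and setting the unknown functions to zero leaves a square equal to 1, so no
coefficient of positive order of Φ (KdV) or G (AKNS, Toda) has a constant term. Since the kernel of
∂, or of the difference, consists of constants, these are the antiderivatives that the recursion
selects. General integration constants multiply the whole solution by 1 + ∑ c_k ζ^k.

Stationarity says that the series cut at order g (with G adjusted) still obeys the recursion. Its
first integral is therefore constant in x or n and, read backwards in z, equals ∏(1 - E_m ζ).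
Multiplication by ∑ c_k(E) ζ^k = ∏(1 - E_m ζ)^(-1/2) turns this value into 1 (`cSeries_sq_mul`). By
uniqueness the product is the homogeneous series. The cut series is the reversal of F_g, namely ∏(1
- μ_l ζ) up to the AKNS prefactor, whose coefficients are Ψ_k; comparing coefficients of ζ^j gives
the formulas.

For sGmKdV, F and H obey a first-order system with G in which the KdV forms of F for w_+ and of H
for w_- both equal ζG² + FH (`IsSgSolution.kdvForm_f`, `IsSgSolution.kdvForm_h`). The same KdV
uniqueness then settles all coefficients below order g, and the one of order g is read off from the
polynomial. -/

noncomputable section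

namespace Soliton

section

open PowerSeries

/-! ### Fixed points of contractions of power series -/

section Contraction

variable {A ι : Type*} [CommRing A]

/-- A map of tuples of power series that improves agreement by one order. -/
def IsContraction (T : (ι → A⟦X⟧) → ι → A⟦X⟧) : Prop :=
  ∀ (n : ℕ) (a b : ι → A⟦X⟧), (∀ i, X ^ n ∣ a i - b i) → ∀ i, X ^ (n + 1) ∣ T a i - T b i

theorem eq_of_forall_X_pow_dvd_sub {f g : A⟦X⟧} (h : ∀ n : ℕ, X ^ n ∣ f - g) : f = g := by
  ext n
  have := X_pow_dvd_iff.1 (h (n + 1)) n (Nat.lt_succ_self n)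
  rwa [map_sub, sub_eq_zero] at this

theorem IsContraction.fixedPoint_unique {T : (ι → A⟦X⟧) → ι → A⟦X⟧} (hT : IsContraction T)
    {a b : ι → A⟦X⟧} (ha : T a = a) (hb : T b = b) : a = b := by
  have key : ∀ n : ℕ, ∀ i, X ^ n ∣ a i - b i := by
    intro n
    induction n with
    | zero => simp
    | succ n ih =>
      intro i
      have := hT n a b ih i
      rwa [ha, hb] at this
  funext i
  exact eq_of_forall_X_pow_dvd_sub fun n => key n i

/-- The iterates of 0 converge ζ-adically: consecutive ones agree to ever higher order, and the
coefficientwise limit is fixed. -/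
theorem IsContraction.exists_fixedPoint {T : (ι → A⟦X⟧) → ι → A⟦X⟧} (hT : IsContraction T) :
    ∃ a, T a = a := by
  let u : ℕ → ι → A⟦X⟧ := fun n => T^[n] 0
  have hu : ∀ n, u (n + 1) = T (u n) := fun n => Function.iterate_succ_apply' T n 0
  have step : ∀ n i, X ^ n ∣ u (n + 1) i - u n i := by
    intro n
    induction n with
    | zero => simp
    | succ n ih =>
      intro i
      rw [hu (n + 1), hu n]
      exact hT n _ _ (by simpa only [← hu n] using ih) i
  have far : ∀ n k i, X ^ n ∣ u (n + k) i - u n i := by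
    intro n k i
    induction k with
    | zero => simp
    | succ k ih =>
      have h1 := (pow_dvd_pow X (Nat.le_add_right n k)).trans (step (n + k) i)
      have := dvd_add h1 ih
      rwa [sub_add_sub_cancel] at this
  -- The coefficient of order `n` no longer changes from iterate `n + 1` on.
  let a : ι → A⟦X⟧ := fun i => mk fun n => coeff n (u (n + 1) i)
  have near : ∀ n i, X ^ n ∣ a i - u n i := by
    intro n i
    rw [X_pow_dvd_iff]
    intro m hm
    obtain ⟨k, rfl⟩ := Nat.exists_eq_add_of_lt hm
    have := X_pow_dvd_iff.1 (far (m + 1) k i) m (Nat.lt_succ_self m)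
    rw [map_sub, sub_eq_zero] at this
    rw [Nat.add_right_comm] at this
    rw [map_sub, coeff_mk, sub_eq_zero, ← this]
  refine ⟨a, funext fun i => eq_of_forall_X_pow_dvd_sub fun n => ?_⟩
  have h1 := hT n a (u n) (near n) i
  rw [← hu n] at h1
  have h2 := near (n + 1) i
  have h3 := (pow_dvd_pow X (Nat.le_succ n)).trans (dvd_sub h1 h2)
  rwa [sub_sub_sub_cancel_right] at h3

end Contraction

/-! ### Coefficientwise derivations -/

section Derivation

variable {A B : Type*} [CommRing A] [Algebra ℂ A] [CommRing B] [Algebra ℂ B]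

/-- The derivation of `A⟦X⟧` that applies `D` to every coefficient. -/
def coeffDeriv (D : Derivation ℂ A A) : Derivation ℂ A⟦X⟧ A⟦X⟧ :=
  Derivation.mk'
    { toFun := fun f => mk fun n => D (coeff n f)
      map_add' := fun f g => by ext n; simp
      map_smul' := fun r f => by ext n; simp }
    fun f g => by
      ext n
      simp only [LinearMap.coe_mk, AddHom.coe_mk, coeff_mk, coeff_mul, map_sum, Derivation.leibniz,
        smul_eq_mul, Finset.sum_add_distrib, map_add]
      congr 1
      rw [← Finset.Nat.sum_antidiagonal_swap]
      simp

@[simp] theorem coeff_coeffDeriv (D : Derivation ℂ A A) (f : A⟦X⟧) (n : ℕ) :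
    coeff n (coeffDeriv D f) = D (coeff n f) := by
  simp [coeffDeriv]

@[simp] theorem coeffDeriv_X (D : Derivation ℂ A A) : coeffDeriv D X = 0 := by
  ext n
  simp only [coeff_coeffDeriv, coeff_X, map_zero]
  split_ifs <;> simp

@[simp] theorem coeffDeriv_C (D : Derivation ℂ A A) (r : A) : coeffDeriv D (C r) = C (D r) := by
  ext n
  simp only [coeff_coeffDeriv, coeff_C]
  split_ifs <;> simp

@[simp] theorem coeffDeriv_map_algebraMap (D : Derivation ℂ A A) (s : ℂ⟦X⟧) :
    coeffDeriv D (map (algebraMap ℂ A) s) = 0 := by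
  ext n
  simp

@[simp] theorem coeffDeriv_X_mul (D : Derivation ℂ A A) (f : A⟦X⟧) :
    coeffDeriv D (X * f) = X * coeffDeriv D f := by
  simp

/-- A coefficientwise derivation loses no order in ζ. Hence derivatives multiplied by ζ do not spoil
the contraction property. -/
theorem X_pow_dvd_coeffDeriv_sub (D : Derivation ℂ A A) {n : ℕ} {f g : A⟦X⟧}
    (h : X ^ n ∣ f - g) : X ^ n ∣ coeffDeriv D f - coeffDeriv D g := by
  rw [X_pow_dvd_iff] at h ⊢
  intro m hm
  rw [map_sub, coeff_coeffDeriv, coeff_coeffDeriv, ← map_sub, ← map_sub, h m hm, map_zero]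

theorem map_coeffDeriv {D : Derivation ℂ A A} {D' : Derivation ℂ B B} {e : A →+* B}
    (he : ∀ a, e (D a) = D' (e a)) (f : A⟦X⟧) :
    map e (coeffDeriv D f) = coeffDeriv D' (map e f) := by
  ext n
  simp [he]

end Derivation

/-! ### The square root of `∏ (1 - E_m ζ)⁻¹` -/

/-- The Taylor series of `(1 - t)^(-1/2)`. -/
def invSqrtSeries : ℂ⟦X⟧ :=
  mk fun j => ((Nat.doubleFactorial (2 * j - 1) : ℕ) : ℂ) / ((Nat.factorial j : ℕ) : ℂ) / 2 ^ j

theorem coeff_succ_invSqrtSeries (j : ℕ) :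
    2 * ((j : ℂ) + 1) * coeff (j + 1) invSqrtSeries = (2 * j + 1) * coeff j invSqrtSeries := by
  have h1 : Nat.doubleFactorial (2 * (j + 1) - 1) = (2 * j + 1) * Nat.doubleFactorial (2 * j - 1) := by
    -- At `j = 0` the truncated subtraction makes both double factorials equal to 1; the two-step
    -- recursion starts at `j = 1`.
    cases j with
    | zero => rfl
    | succ j => exact Nat.doubleFactorial_add_two (2 * j + 1)
  have h2 : (j : ℂ) + 1 ≠ 0 := by exact_mod_cast j.succ_ne_zero
  have h3 : ((Nat.factorial j : ℕ) : ℂ) ≠ 0 := by exact_mod_cast j.factorial_ne_zero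
  simp only [invSqrtSeries, coeff_mk, h1, Nat.factorial_succ]
  push_cast
  field_simp
  ring

/-- The coefficient recursion is the differential equation 2(1 - t)y' = y. It makes the derivative
of y²(1 - t) vanish, and the constant term is 1. -/
theorem invSqrtSeries_sq : invSqrtSeries ^ 2 * (1 - X) = 1 := by
  have ode : 2 * (1 - X) * derivative ℂ invSqrtSeries = invSqrtSeries := by
    ext n
    have h : 2 * (1 - X) * derivative ℂ invSqrtSeries
        = C 2 * derivative ℂ invSqrtSeries - C 2 * (X * derivative ℂ invSqrtSeries) := by
      rw [map_ofNat]; ring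
    rw [h, map_sub, coeff_C_mul, coeff_C_mul, coeff_derivative]
    have := coeff_succ_invSqrtSeries n
    cases n with
    | zero => simp at this ⊢; linear_combination this
    | succ n =>
      rw [coeff_succ_X_mul, coeff_derivative]
      push_cast at this ⊢
      linear_combination this
  apply derivative.ext
  · simp only [Derivation.leibniz, Derivation.leibniz_pow, map_sub, smul_eq_mul, nsmul_eq_mul,
      Derivation.map_one_eq_zero, derivative_X]
    push_cast
    linear_combination invSqrtSeries * ode
  · simp [invSqrtSeries]

/-- `∑ c_k(E) ζ^k`. -/
def cSeries {M : ℕ} (E : Fin M → ℂ) : ℂ⟦X⟧ := ∏ m, rescale (E m) invSqrtSeries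

theorem coeff_cSeries {M : ℕ} (E : Fin M → ℂ) (k : ℕ) : coeff k (cSeries E) = cCoeff k E := by
  rw [cSeries, coeff_prod, cCoeff]
  refine Finset.sum_bij' (fun l _ => ⇑l) (fun j _ => Finsupp.equivFunOnFinite.symm j) ?_ ?_ ?_ ?_ ?_
  · intro l hl
    simpa [Finset.mem_finsuppAntidiag] using hl
  · intro j hj
    simpa [Finset.mem_finsuppAntidiag] using hj
  · intro l _
    ext; simp
  · intro j _
    ext; simp
  · intro l hl
    have hk : ∑ m, l m = k := by simpa [Finset.mem_finsuppAntidiag] using hl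
    rw [← hk, ← Finset.prod_pow_eq_pow_sum, ← Finset.prod_div_distrib]
    refine Finset.prod_congr rfl fun m _ => ?_
    rw [coeff_rescale, invSqrtSeries, coeff_mk]
    ring

/-- `∏ (1 - μ_l ζ)`. -/
def rootSeries {M : ℕ} (E : Fin M → ℂ) : ℂ⟦X⟧ := ∏ m, (1 - C (E m) * X)

/-- This rescales a quadratic first integral with value ∏(1 - E_m ζ) to one with value 1. -/
theorem cSeries_sq_mul {M : ℕ} (E : Fin M → ℂ) : cSeries E ^ 2 * rootSeries E = 1 := by
  rw [cSeries, rootSeries, ← Finset.prod_pow, ← Finset.prod_mul_distrib]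
  refine Finset.prod_eq_one fun m _ => ?_
  have := congrArg (rescale (E m)) invSqrtSeries_sq
  simpa [rescale_X] using this

theorem constantCoeff_cSeries {M : ℕ} (E : Fin M → ℂ) : constantCoeff (cSeries E) = 1 := by
  rw [cSeries, map_prod]
  refine Finset.prod_eq_one fun m _ => ?_
  rw [← coeff_zero_eq_constantCoeff_apply, coeff_rescale]
  simp [invSqrtSeries]

/-- Vieta: the product expands over subsets of the index set, and a subset of size `k` contributes
to ζ^k. -/
theorem coeff_rootSeries {g : ℕ} (μ : Fin g → ℂ) (k : ℕ) : coeff k (rootSeries μ) = Psi k μ := by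
  have h : rootSeries μ = ∑ s ∈ (Finset.univ : Finset (Fin g)).powerset,
      C ((-1) ^ s.card * ∏ l ∈ s, μ l) * X ^ s.card := by
    rw [rootSeries]
    simp_rw [sub_eq_add_neg, add_comm (1 : ℂ⟦X⟧)]
    rw [Finset.prod_add]
    refine Finset.sum_congr rfl fun s _ => ?_
    simp only [Finset.prod_const_one, mul_one, Finset.prod_neg, Finset.prod_mul_distrib,
      Finset.prod_const, map_mul, map_pow, map_neg, map_one, map_prod]
    ring
  rw [h, map_sum, Psi, Finset.mul_sum, Finset.powersetCard_eq_filter, Finset.sum_filter]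
  refine Finset.sum_congr rfl fun s _ => ?_
  rw [coeff_C_mul, coeff_X_pow]
  by_cases hs : s.card = k
  · simp [hs]
  · simp [hs, Ne.symm hs]

theorem Psi_eq_zero {g : ℕ} (μ : Fin g → ℂ) {k : ℕ} (hk : g < k) : Psi k μ = 0 := by
  rw [Psi, Finset.powersetCard_eq_empty.2 (by simpa using hk)]
  simp

theorem coeff_cSeries_mul_rootSeries {M g : ℕ} (E : Fin M → ℂ) (μ : Fin g → ℂ) (j : ℕ) :
    coeff j (cSeries E * rootSeries μ)
      = ∑ k ∈ Finset.range (j + 1), cCoeff (j - k) E * Psi k μ := by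
  rw [mul_comm, coeff_mul, Finset.Nat.sum_antidiagonal_eq_sum_range_succ_mk]
  refine Finset.sum_congr rfl fun k _ => ?_
  rw [coeff_cSeries, coeff_rootSeries, mul_comm]

theorem coeff_cSeries_mul_rootSeries' {M g : ℕ} (E : Fin M → ℂ) (μ : Fin g → ℂ) (j : ℕ) :
    coeff j (cSeries E * rootSeries μ)
      = ∑ k ∈ Finset.range (min j g + 1), cCoeff (j - k) E * Psi k μ := by
  rw [coeff_cSeries_mul_rootSeries]
  symm
  refine Finset.sum_subset (Finset.range_mono (by omega)) fun k hk hk' => ?_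
  simp only [Finset.mem_range] at hk hk'
  rw [Psi_eq_zero μ (by omega), mul_zero]

/-! ### Reversal of polynomials in `z` -/

/-- `ζ^n P(1/ζ)` as a power series. -/
def revSeries (n : ℕ) (P : Polynomial ℂ) : ℂ⟦X⟧ := (P.reflect n : Polynomial ℂ)

theorem revSeries_add (n : ℕ) (P Q : Polynomial ℂ) :
    revSeries n (P + Q) = revSeries n P + revSeries n Q := by
  simp [revSeries, Polynomial.reflect_add]

theorem revSeries_sub (n : ℕ) (P Q : Polynomial ℂ) :
    revSeries n (P - Q) = revSeries n P - revSeries n Q := by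
  simp [revSeries, Polynomial.reflect_sub]

theorem revSeries_C_mul (n : ℕ) (r : ℂ) (P : Polynomial ℂ) :
    revSeries n (Polynomial.C r * P) = C r * revSeries n P := by
  simp [revSeries]

theorem revSeries_mul {m n : ℕ} {P Q : Polynomial ℂ} (hP : P.natDegree ≤ m)
    (hQ : Q.natDegree ≤ n) : revSeries (m + n) (P * Q) = revSeries m P * revSeries n Q := by
  simp [revSeries, Polynomial.reflect_mul P Q hP hQ]

theorem coeff_revSeries_of_le {n k : ℕ} (P : Polynomial ℂ) (hk : k ≤ n) :
    coeff k (revSeries n P) = P.coeff (n - k) := by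
  rw [revSeries, Polynomial.coeff_coe, Polynomial.coeff_reflect, Polynomial.revAt_le hk]

theorem coeff_revSeries_of_lt {n k : ℕ} {P : Polynomial ℂ} (hP : P.natDegree ≤ n) (hk : n < k) :
    coeff k (revSeries n P) = 0 := by
  rw [revSeries, Polynomial.coeff_coe, Polynomial.coeff_reflect,
    Polynomial.revAt_eq_self_of_lt hk]
  exact Polynomial.coeff_eq_zero_of_natDegree_lt (hP.trans_lt hk)

theorem revSeries_X_pow_mul {m n : ℕ} {P : Polynomial ℂ} (hP : P.natDegree ≤ n) :
    revSeries (m + n) (Polynomial.X ^ m * P) = revSeries n P := by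
  rw [revSeries_mul (Polynomial.natDegree_X_pow_le m) hP]
  simp [revSeries, Polynomial.reflect_monomial]

/-- Unused degrees turn into powers of ζ under reversal. The explicit powers of ζ in the quadratic
forms come from here. -/
theorem revSeries_of_natDegree_le {m n : ℕ} {P : Polynomial ℂ} (hP : P.natDegree ≤ n) :
    revSeries (m + n) P = X ^ m * revSeries n P := by
  have := revSeries_mul (m := m) (P := 1) (by simp) hP
  rw [one_mul] at this
  rw [this]
  congr 1
  rw [revSeries, ← Polynomial.C_1, Polynomial.reflect_C]
  simp

theorem natDegree_zPoly_le (n : ℕ) (a : ℕ → ℂ) : (zPoly (n + 1) a).natDegree ≤ n := by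
  refine Polynomial.natDegree_sum_le_of_forall_le _ _ fun j hj => ?_
  exact (Polynomial.natDegree_C_mul_X_pow_le _ _).trans (Nat.lt_succ_iff.1 (Finset.mem_range.1 hj))

theorem coeff_revSeries_zPoly (n : ℕ) (a : ℕ → ℂ) (k : ℕ) :
    coeff k (revSeries n (zPoly (n + 1) a)) = if k ≤ n then a k else 0 := by
  split_ifs with hk
  · rw [coeff_revSeries_of_le _ hk, zPoly, Polynomial.finsetSum_coeff,
      Finset.sum_eq_single (n - k)]
    · rw [Polynomial.coeff_C_mul_X_pow, if_pos rfl]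
      congr 1
      omega
    · intro b _ hb
      rw [Polynomial.coeff_C_mul_X_pow, if_neg (Ne.symm hb)]
    · intro h
      simp at h
  · exact coeff_revSeries_of_lt (natDegree_zPoly_le n a) (by omega)

theorem natDegree_rootPoly {M : ℕ} (E : Fin M → ℂ) : (rootPoly E).natDegree = M := by
  rw [rootPoly, Polynomial.natDegree_prod_of_monic _ _ fun m _ => Polynomial.monic_X_sub_C _]
  simp

theorem revSeries_rootPoly {M : ℕ} (E : Fin M → ℂ) : revSeries M (rootPoly E) = rootSeries E := by
  induction M with
  | zero =>
    have h : Polynomial.reflect 0 (1 : Polynomial ℂ) = 1 := by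
      rw [← Polynomial.C_1, Polynomial.reflect_C]
      simp
    simp [rootPoly, rootSeries, revSeries, h]
  | succ M ih =>
    have h1 : rootPoly E = rootPoly (fun m : Fin M => E m.castSucc) *
        (Polynomial.X - Polynomial.C (E (Fin.last M))) := by
      simp [rootPoly, Fin.prod_univ_castSucc]
    rw [h1, revSeries_mul (natDegree_rootPoly _).le (Polynomial.natDegree_X_sub_C_le _), ih,
      rootSeries, rootSeries, Fin.prod_univ_castSucc]
    congr 1
    rw [revSeries, Polynomial.reflect_sub, Polynomial.reflect_C, ← pow_one Polynomial.X,
      Polynomial.reflect_monomial]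
    simp

end

/-! ### Kernels of `∂` and of the backward difference -/

theorem eq_C_of_forall_pderiv_eq_zero {σ : Type*} {P : MvPolynomial σ ℂ}
    (h : ∀ i, MvPolynomial.pderiv i P = 0) : P = MvPolynomial.C (MvPolynomial.constantCoeff P) := by
  classical
  ext m
  rw [MvPolynomial.coeff_C]
  split_ifs with hm
  · rw [← hm]; rfl
  · obtain ⟨i, hi⟩ : ∃ i, m i ≠ 0 := by
      by_contra! hc
      exact hm (Finsupp.ext fun i => (hc i).symm)
    -- The coefficient at `m` reappears in this partial derivative, multiplied by the exponent `m
    -- i`, which is nonzero in characteristic 0.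
    have h1 := congrArg (MvPolynomial.coeff (m - Finsupp.single i 1)) (h i)
    rw [MvPolynomial.coeff_pderiv, MvPolynomial.coeff_zero, tsub_add_cancel_of_le
      (Finsupp.single_le_iff.2 (Nat.one_le_iff_ne_zero.2 hi))] at h1
    refine (mul_eq_zero.1 h1).resolve_right ?_
    exact Nat.cast_add_one_ne_zero _

/-- `∂` as a derivation. -/
def dxDer (ι : Type) : Derivation ℂ (DiffPoly ι) (DiffPoly ι) :=
  MvPolynomial.mkDerivation ℂ (fun v : ι × ℕ => (MvPolynomial.X (v.1, v.2 + 1) : DiffPoly ι))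

theorem dx_apply {ι : Type} (P : DiffPoly ι) : dx ι P = dxDer ι P := rfl

@[simp] theorem dxDer_X {ι : Type} (v : ι × ℕ) :
    dxDer ι (MvPolynomial.X v) = MvPolynomial.X (v.1, v.2 + 1) :=
  MvPolynomial.mkDerivation_X _ _ _

theorem constantCoeff_dxDer {ι : Type} (P : DiffPoly ι) :
    MvPolynomial.constantCoeff (dxDer ι P) = 0 := by
  induction P using MvPolynomial.induction_on with
  | C a => simp [← MvPolynomial.algebraMap_eq]
  | add p q hp hq => simp [hp, hq]
  | mul_X p v hp => simp [hp]

/-- The commutator of ∂/∂u^(k+1) with ∂ is ∂/∂u^(k), because both sides are derivations agreeing on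
the variables. -/
theorem pderiv_succ_dxDer {ι : Type} (i : ι) (k : ℕ) (P : DiffPoly ι) :
    MvPolynomial.pderiv (i, k + 1) (dxDer ι P)
      = dxDer ι (MvPolynomial.pderiv (i, k + 1) P) + MvPolynomial.pderiv (i, k) P := by
  classical
  induction P using MvPolynomial.induction_on with
  | C a => simp [← MvPolynomial.algebraMap_eq]
  | add p q hp hq => simp only [map_add, hp, hq]; ring
  | mul_X p v hp =>
    have h : MvPolynomial.pderiv (i, k + 1) (MvPolynomial.X (v.1, v.2 + 1) : DiffPoly ι)
        = MvPolynomial.pderiv (i, k) (MvPolynomial.X v) := by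
      rw [MvPolynomial.pderiv_X, MvPolynomial.pderiv_X]
      obtain ⟨a, b⟩ := v
      simp [Pi.single_apply]
    have h' : dxDer ι (MvPolynomial.pderiv (i, k + 1) (MvPolynomial.X v : DiffPoly ι)) = 0 := by
      rw [MvPolynomial.pderiv_X, Pi.single_apply]
      split_ifs <;> simp
    simp only [Derivation.leibniz, smul_eq_mul, map_add, dxDer_X, hp, h, h']
    ring

/-- If ∂P = 0, the commutator relation passes the vanishing of ∂P/∂u^(k+1) down to ∂P/∂u^(k). The
descent starts just above the highest derivative occurring in P. -/
theorem eq_C_of_dxDer_eq_zero {ι : Type} {P : DiffPoly ι} (h : dxDer ι P = 0) :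
    P = MvPolynomial.C (MvPolynomial.constantCoeff P) := by
  classical
  refine eq_C_of_forall_pderiv_eq_zero fun ⟨i, k⟩ => ?_
  have down : ∀ n k, k + n = P.vars.sup Prod.snd + 1 → MvPolynomial.pderiv (i, k) P = 0 := by
    intro n
    induction n with
    | zero =>
      intro k hk
      refine MvPolynomial.pderiv_eq_zero_of_notMem_vars fun hmem => ?_
      have := Finset.le_sup (f := Prod.snd) hmem
      simp only at this
      omega
    | succ n ih =>
      intro k hk
      have := pderiv_succ_dxDer i k P
      rw [h, ih (k + 1) (by omega)] at this
      simpa using this.symm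
  by_cases hk : k ≤ P.vars.sup Prod.snd + 1
  · exact down _ k (Nat.add_sub_cancel' hk)
  · refine MvPolynomial.pderiv_eq_zero_of_notMem_vars fun hmem => ?_
    have := Finset.le_sup (f := Prod.snd) hmem
    simp only at this
    omega

/-- A variable of P with the largest shift index would have to be the backward shift of a variable
of P with a larger index. -/
theorem eq_C_of_shift_eq {ι : Type} {P : DiffcePoly ι} (h : shift (-1) P = P) :
    P = MvPolynomial.C (MvPolynomial.constantCoeff P) := by
  classical
  refine MvPolynomial.vars_eq_empty_iff_eq_C.1 ?_
  by_contra hne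
  obtain ⟨v, hv, hmax⟩ :=
    Finset.exists_max_image P.vars Prod.snd (Finset.nonempty_iff_ne_empty.2 hne)
  rw [← h] at hv
  obtain ⟨w, hw, rfl⟩ := Finset.mem_image.1 (MvPolynomial.vars_rename _ _ hv)
  have := hmax w hw
  simp only at this
  omega

/-! ### Integration -/

/-- Any known antiderivative evaluates `integral` and excludes its default value 0. In the
hierarchies the antiderivative is a coefficient of the series solution, so integrability needs no
separate proof. -/
theorem integral_eq {σ : Type} {T : MvPolynomial σ ℂ →ₗ[ℂ] MvPolynomial σ ℂ}
    (hT : ∀ P, T P = 0 → P = MvPolynomial.C (MvPolynomial.constantCoeff P))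
    (hC : ∀ r, T (MvPolynomial.C r) = 0) {P Q : MvPolynomial σ ℂ} (h : T Q = P) :
    integral T P = Q - MvPolynomial.C (MvPolynomial.constantCoeff Q) := by
  have hex : ∃ Q, MvPolynomial.constantCoeff Q = 0 ∧ T Q = P :=
    ⟨Q - MvPolynomial.C (MvPolynomial.constantCoeff Q), by simp, by rw [map_sub, hC, h, sub_zero]⟩
  rw [integral, dif_pos hex]
  obtain ⟨h1, h2⟩ := hex.choose_spec
  have := hT (Q - hex.choose) (by rw [map_sub, h, h2, sub_self])
  rw [map_sub, h1, sub_zero] at this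
  rw [← this]
  ring

theorem integral_dx_eq {ι : Type} {P Q : DiffPoly ι} (h : dxDer ι Q = P) :
    integral (dx ι) P = Q - MvPolynomial.C (MvPolynomial.constantCoeff Q) :=
  integral_eq (fun _ hP => eq_C_of_dxDer_eq_zero hP)
    (fun r => by simp [← MvPolynomial.algebraMap_eq]) h

theorem integral_bdiff_eq {ι : Type} {P Q : DiffcePoly ι} (h : Q - shift (-1) Q = P) :
    integral (bdiff ι) P = Q - MvPolynomial.C (MvPolynomial.constantCoeff Q) := by
  refine integral_eq (fun R hR => eq_C_of_shift_eq ?_) (fun r => ?_) h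
  · exact (sub_eq_zero.1 hR).symm
  · simp [bdiff, ← MvPolynomial.algebraMap_eq]

/-! ### Smooth functions -/

/-- The algebra of smooth functions. -/
def Smooth : Subalgebra ℂ (ℝ → ℂ) where
  carrier := {f | ContDiff ℝ ∞ f}
  mul_mem' {f g} hf hg := by
    have hf' : ContDiff ℝ ∞ f := hf
    exact hf'.mul hg
  add_mem' {f g} hf hg := by
    have hf' : ContDiff ℝ ∞ f := hf
    exact hf'.add hg
  algebraMap_mem' r := by
    have h : ContDiff ℝ ∞ (fun _ : ℝ => r) := contDiff_const
    exact h

theorem contDiff_deriv {f : ℝ → ℂ} (hf : ContDiff ℝ ∞ f) : ContDiff ℝ ∞ (deriv f) :=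
  (contDiff_infty_iff_deriv.1 hf).2

theorem differentiableAt_smooth {f : ℝ → ℂ} (hf : ContDiff ℝ ∞ f) (x : ℝ) :
    DifferentiableAt ℝ f x :=
  (contDiff_infty_iff_deriv.1 hf).1 x

/-- Differentiation of smooth functions. -/
def Smooth.der : Derivation ℂ Smooth Smooth :=
  Derivation.mk'
    { toFun := fun f => ⟨deriv f.1, contDiff_deriv f.2⟩
      map_add' := fun f g => Subtype.ext <| funext fun x =>
        deriv_add (differentiableAt_smooth f.2 x) (differentiableAt_smooth g.2 x)
      map_smul' := fun r f => Subtype.ext <| funext fun x =>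
        deriv_const_smul r (differentiableAt_smooth f.2 x) }
    fun f g => Subtype.ext <| funext fun x => by
      have := deriv_mul (differentiableAt_smooth f.2 x) (differentiableAt_smooth g.2 x)
      refine this.trans ?_
      simp only [LinearMap.coe_mk, AddHom.coe_mk, smul_eq_mul, Subalgebra.coe_add,
        Subalgebra.coe_mul, Pi.add_apply, Pi.mul_apply]
      ring

@[simp] theorem Smooth.coe_der (f : Smooth) : (Smooth.der f : ℝ → ℂ) = deriv f.1 := rfl

/-- Evaluation at a point. -/
def Smooth.evalAt (x : ℝ) : Smooth →ₐ[ℂ] ℂ := (Pi.evalAlgHom ℂ (fun _ : ℝ => ℂ) x).comp Smooth.val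

theorem Smooth.ext_evalAt {f g : Smooth} (h : ∀ x, f.1 x = g.1 x) : f = g :=
  Subtype.ext (funext h)

theorem Smooth.evalAt_eq_of_der_eq_zero {f : Smooth} (h : Smooth.der f = 0) (x y : ℝ) :
    Smooth.evalAt x f = Smooth.evalAt y f := by
  refine is_const_of_deriv_eq_zero (fun x => differentiableAt_smooth f.2 x) (fun x => ?_) x y
  exact congrFun (congrArg Subtype.val h) x

theorem Smooth.eq_algebraMap_of_der_eq_zero {f : Smooth} (h : Smooth.der f = 0) (x : ℝ) :
    f = algebraMap ℂ Smooth (Smooth.evalAt x f) :=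
  Smooth.ext_evalAt fun y => Smooth.evalAt_eq_of_der_eq_zero h y x

/-- An x-independent series is known from its value at one point; hence prescribing the zeros of R
at a single `x₀` suffices. -/
theorem Smooth.eq_map_of_coeffDeriv_eq_zero {f : PowerSeries Smooth}
    (h : coeffDeriv Smooth.der f = 0) (x : ℝ) :
    f = PowerSeries.map (algebraMap ℂ Smooth)
      (PowerSeries.map (Smooth.evalAt x : Smooth →+* ℂ) f) := by
  ext1 n
  rw [PowerSeries.coeff_map, PowerSeries.coeff_map]
  refine Smooth.eq_algebraMap_of_der_eq_zero ?_ x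
  rw [← coeff_coeffDeriv, h, map_zero]

theorem Smooth.map_evalAt_map_algebraMap (x : ℝ) (s : PowerSeries ℂ) :
    PowerSeries.map (Smooth.evalAt x : Smooth →+* ℂ)
      (PowerSeries.map (algebraMap ℂ Smooth) s) = s := by
  ext n
  rfl

/-- Smooth functions as elements of the algebra, differentiated `k` times. -/
def Smooth.iterDer (f : Smooth) (k : ℕ) : Smooth := (⇑Smooth.der)^[k] f

theorem Smooth.coe_iterDer (f : Smooth) (k : ℕ) :
    (Smooth.iterDer f k : ℝ → ℂ) = iteratedDeriv k f.1 := by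
  induction k with
  | zero => simp [Smooth.iterDer]
  | succ k ih =>
    rw [iteratedDeriv_succ, ← ih, Smooth.iterDer, Function.iterate_succ_apply']
    rfl

/-- Evaluation of differential polynomials at smooth functions. -/
def evalDiff {ι : Type} (u : ι → Smooth) : DiffPoly ι →ₐ[ℂ] Smooth :=
  MvPolynomial.aeval fun v => Smooth.iterDer (u v.1) v.2

theorem evalDiff_dxDer {ι : Type} (u : ι → Smooth) (P : DiffPoly ι) :
    evalDiff u (dxDer ι P) = Smooth.der (evalDiff u P) := by
  induction P using MvPolynomial.induction_on with
  | C a => simp [← MvPolynomial.algebraMap_eq]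
  | add p q hp hq => simp [hp, hq]
  | mul_X p v hp =>
    have : Smooth.iterDer (u v.1) (v.2 + 1) = Smooth.der (Smooth.iterDer (u v.1) v.2) :=
      Function.iterate_succ_apply' _ _ _
    have h2 : ∀ w, evalDiff u (MvPolynomial.X w) = Smooth.iterDer (u w.1) w.2 := fun w => by
      simp [evalDiff]
    simp only [Derivation.leibniz, smul_eq_mul, map_add, map_mul, dxDer_X, hp, h2, this]

theorem coe_evalDiff {ι : Type} (u : ι → Smooth) (P : DiffPoly ι) (x : ℝ) :
    (evalDiff u P).1 x = DiffPoly.at (fun i => (u i).1) P x := by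
  rw [DiffPoly.at]
  induction P using MvPolynomial.induction_on with
  | C a => rw [MvPolynomial.eval_C, ← MvPolynomial.algebraMap_eq, AlgHom.commutes]; rfl
  | add p q hp hq => rw [map_add, map_add, ← hp, ← hq]; rfl
  | mul_X p v hp =>
    rw [map_mul, map_mul, ← hp, MvPolynomial.eval_X, ← Smooth.coe_iterDer, evalDiff,
      MvPolynomial.aeval_X]
    rfl

theorem coe_evalDiff' {ι : Type} (u : ι → Smooth) (P : DiffPoly ι) :
    (evalDiff u P).1 = DiffPoly.at (fun i => (u i).1) P :=
  funext fun x => coe_evalDiff u P x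

section

open PowerSeries

/-! ### The KdV quadratic form -/

theorem exists_eq_one_add_X_mul {A : Type*} [CommRing A] {Φ : A⟦X⟧} (h : constantCoeff Φ = 1) : ∃ Y, Φ = 1 + X * Y := by
  have : X ∣ Φ - 1 := X_dvd_iff.2 (by simp [h])
  obtain ⟨Y, hY⟩ := this
  exact ⟨Y, by linear_combination hY⟩

theorem isUnit_of_constantCoeff_eq_one {A : Type*} [CommRing A] {Φ : A⟦X⟧} (h : constantCoeff Φ = 1) : IsUnit Φ :=
  isUnit_iff_constantCoeff.2 (h ▸ isUnit_one)

theorem constantCoeff_map_eq_one {A B : Type*} [CommRing A] [CommRing B] (e : A →+* B) {Φ : A⟦X⟧}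
    (h : constantCoeff Φ = 1) : constantCoeff (map e Φ) = 1 := by
  rw [← coeff_zero_eq_constantCoeff_apply, coeff_map, coeff_zero_eq_constantCoeff_apply, h, map_one]

section KdVForm

variable {A B : Type*} [CommRing A] [Algebra ℂ A] [CommRing B] [Algebra ℂ B]

/-- The constant `1 / 2`. -/
def half (A : Type*) [CommRing A] [Algebra ℂ A] : A := algebraMap ℂ A (1 / 2)

theorem two_mul_half (A : Type*) [CommRing A] [Algebra ℂ A] : 2 * half A = 1 := by
  rw [half, ← map_ofNat (algebraMap ℂ A) 2, ← map_mul]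
  norm_num

@[simp] theorem coeffDeriv_half (D : Derivation ℂ A A) : coeffDeriv D (half A⟦X⟧) = 0 :=
  Derivation.map_algebraMap _ _

theorem half_eq_C (A : Type*) [CommRing A] [Algebra ℂ A] : half A⟦X⟧ = C (half A) :=
  PowerSeries.algebraMap_apply

@[simp] theorem map_half (e : A →ₐ[ℂ] B) : map (e : A →+* B) (half A⟦X⟧) = half B⟦X⟧ := by
  rw [half_eq_C, half_eq_C, map_C, half, half]
  simp

/-- `Φ² + ζ (½ Φ Φ'' - ¼ Φ'² - V Φ²)`. -/
def kdvForm (D : Derivation ℂ A A) (V : A) (Φ : A⟦X⟧) : A⟦X⟧ :=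
  Φ ^ 2 + X * (half _ * coeffDeriv D (coeffDeriv D Φ) * Φ - half _ ^ 2 * coeffDeriv D Φ ^ 2
    - C V * Φ ^ 2)

/-- `-¼ Φ''' + V Φ' + ½ V' Φ`. -/
def kdvOp (D : Derivation ℂ A A) (V : A) (Φ : A⟦X⟧) : A⟦X⟧ :=
  -half _ ^ 2 * coeffDeriv D (coeffDeriv D (coeffDeriv D Φ)) + C V * coeffDeriv D Φ
    + half _ * C (D V) * Φ

/-- The form is a first integral: its derivative factors through the defect of the linear recursion
Φ' = ζ · `kdvOp`. -/
theorem coeffDeriv_kdvForm (D : Derivation ℂ A A) (V : A) (Φ : A⟦X⟧) :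
    coeffDeriv D (kdvForm D V Φ) = 2 * Φ * (coeffDeriv D Φ - X * kdvOp D V Φ) := by
  simp only [kdvForm, kdvOp, map_add, map_sub, Derivation.leibniz, Derivation.leibniz_pow,
    smul_eq_mul, coeffDeriv_X, coeffDeriv_half, coeffDeriv_C, nsmul_eq_mul]
  push_cast
  linear_combination X * (coeffDeriv D (coeffDeriv D Φ) * coeffDeriv D Φ * -half A⟦X⟧
    - Φ * coeffDeriv D (coeffDeriv D (coeffDeriv D Φ)) * half A⟦X⟧
    + Φ ^ 2 * C (D V)) * two_mul_half A⟦X⟧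

theorem kdvForm_mul (D : Derivation ℂ A A) (V : A) {s : A⟦X⟧} (hs : coeffDeriv D s = 0)
    (Φ : A⟦X⟧) : kdvForm D V (s * Φ) = s ^ 2 * kdvForm D V Φ := by
  simp only [kdvForm, Derivation.leibniz, smul_eq_mul, hs, mul_zero, add_zero]
  ring

theorem kdvOp_mul (D : Derivation ℂ A A) (V : A) {s : A⟦X⟧} (hs : coeffDeriv D s = 0)
    (Φ : A⟦X⟧) : kdvOp D V (s * Φ) = s * kdvOp D V Φ := by
  simp only [kdvOp, Derivation.leibniz, smul_eq_mul, hs, mul_zero, add_zero]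
  ring

theorem map_kdvForm {D : Derivation ℂ A A} {D' : Derivation ℂ B B} {e : A →ₐ[ℂ] B}
    (he : ∀ a, e (D a) = D' (e a)) (V : A) (Φ : A⟦X⟧) :
    map (e : A →+* B) (kdvForm D V Φ) = kdvForm D' (e V) (map (e : A →+* B) Φ) := by
  have h := map_coeffDeriv (D := D) (D' := D') (e := (e : A →+* B)) he
  simp only [kdvForm, map_add, map_mul, map_sub, map_pow, h, map_X, map_C, map_half]
  rfl

/-- The map whose fixed points `Y` are the solutions `1 + ζ Y` of `kdvForm = 1`. -/
def kdvMap (D : Derivation ℂ A A) (V : A) (Y : Unit → A⟦X⟧) : Unit → A⟦X⟧ := fun _ =>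
  -half _ * (X * Y () ^ 2 + half _ * (X * coeffDeriv D (coeffDeriv D (Y ()))) * (1 + X * Y ())
    - half _ ^ 2 * (X * coeffDeriv D (Y ())) ^ 2 - C V * (1 + X * Y ()) ^ 2)

/-- Every occurrence of the unknown or of its derivatives carries a factor ζ; the witness is the
corresponding difference quotient. -/
theorem kdvMap_isContraction (D : Derivation ℂ A A) (V : A) : IsContraction (kdvMap D V) := by
  intro n Y Z h _
  obtain ⟨w, hw⟩ := h ()
  obtain ⟨w', hw'⟩ := X_pow_dvd_coeffDeriv_sub D (h ())
  obtain ⟨w'', hw''⟩ := X_pow_dvd_coeffDeriv_sub D (X_pow_dvd_coeffDeriv_sub D (h ()))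
  simp only [kdvMap]
  generalize coeffDeriv D (coeffDeriv D (Y ())) = y2 at *
  generalize coeffDeriv D (coeffDeriv D (Z ())) = z2 at *
  generalize coeffDeriv D (Y ()) = y1 at *
  generalize coeffDeriv D (Z ()) = z1 at *
  refine ⟨-half _ * ((Y () + Z ()) * w + half _ * (w'' * (1 + X * Y ()) + X * z2 * w)
    - half _ ^ 2 * X * (y1 + z1) * w' - C V * (2 + X * Y () + X * Z ()) * w), ?_⟩
  linear_combination
    -half _ * X * ((Y () + Z ()) + half _ * X * z2 - C V * (2 + X * Y () + X * Z ())) * hw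
    - half _ * half _ * X * (1 + X * Y ()) * hw''
    + half _ * half _ ^ 2 * X * X * (y1 + z1) * hw'

/-- The square of 1 + ζY supplies the linear term 2ζY. Solving for it gives the fixed-point
equation, after cancelling ζ and 2. -/
theorem kdvForm_one_add (D : Derivation ℂ A A) (V : A) (Y : A⟦X⟧) :
    kdvForm D V (1 + X * Y) = 1 ↔ kdvMap D V (fun _ => Y) = fun _ => Y := by
  have h1 : kdvForm D V (1 + X * Y) - 1 = X * (2 * (Y - kdvMap D V (fun _ => Y) ())) := by
    simp only [kdvForm, kdvMap, map_add, Derivation.map_one_eq_zero, zero_add, coeffDeriv_X_mul]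
    linear_combination (-X * (X * Y ^ 2 + half _ * (X * coeffDeriv D (coeffDeriv D Y)) * (1 + X * Y)
      - half _ ^ 2 * (X * coeffDeriv D Y) ^ 2 - C V * (1 + X * Y) ^ 2)) * two_mul_half A⟦X⟧
  constructor
  · intro h
    rw [h, sub_self, ← mul_zero X] at h1
    have h2 := X_mul_cancel h1
    funext _
    linear_combination (Y - kdvMap D V (fun _ => Y) ()) * two_mul_half A⟦X⟧ + half _ * h2
  · intro h
    rw [h, sub_self, mul_zero, mul_zero, sub_eq_zero] at h1
    exact h1

theorem exists_kdvForm_eq_one (D : Derivation ℂ A A) (V : A) :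
    ∃ Φ : A⟦X⟧, constantCoeff Φ = 1 ∧ kdvForm D V Φ = 1 := by
  obtain ⟨Y, hY⟩ := (kdvMap_isContraction D V).exists_fixedPoint
  exact ⟨1 + X * Y (), by simp, (kdvForm_one_add D V _).2 hY⟩

theorem kdvForm_eq_one_unique (D : Derivation ℂ A A) (V : A) {Φ Ψ : A⟦X⟧}
    (hΦ : constantCoeff Φ = 1) (hΦ' : kdvForm D V Φ = 1)
    (hΨ : constantCoeff Ψ = 1) (hΨ' : kdvForm D V Ψ = 1) : Φ = Ψ := by
  obtain ⟨Y, rfl⟩ := exists_eq_one_add_X_mul hΦ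
  obtain ⟨Z, rfl⟩ := exists_eq_one_add_X_mul hΨ
  have := (kdvMap_isContraction D V).fixedPoint_unique ((kdvForm_one_add D V Y).1 hΦ')
    ((kdvForm_one_add D V Z).1 hΨ')
  rw [show Y = Z from congrFun this ()]

theorem isUnit_two (A : Type*) [CommRing A] [Algebra ℂ A] : IsUnit (2 : A) :=
  IsUnit.of_mul_eq_one _ (two_mul_half A)

/-- The factor 2Φ in the derivative of the form is a unit, so constancy of the form gives back the
recursion. -/
theorem coeffDeriv_eq_of_kdvForm {D : Derivation ℂ A A} {V : A} {Φ : A⟦X⟧}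
    (hΦ : constantCoeff Φ = 1) (h : coeffDeriv D (kdvForm D V Φ) = 0) :
    coeffDeriv D Φ = X * kdvOp D V Φ := by
  rw [coeffDeriv_kdvForm] at h
  have hu := (isUnit_two A⟦X⟧).mul (isUnit_of_constantCoeff_eq_one hΦ)
  exact sub_eq_zero.1 ((hu.mul_right_eq_zero).1 h)

theorem coeff_kdvOp (D : Derivation ℂ A A) (V : A) (Φ : A⟦X⟧) (n : ℕ) :
    coeff n (kdvOp D V Φ) = algebraMap ℂ A (-1 / 4) * D (D (D (coeff n Φ))) + V * D (coeff n Φ)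
      + algebraMap ℂ A (1 / 2) * D V * coeff n Φ := by
  have e : -half A⟦X⟧ ^ 2 = C (algebraMap ℂ A (-1 / 4)) := by
    rw [half_eq_C, half, ← map_pow, ← map_pow, ← map_neg, ← map_neg]
    norm_num
  rw [kdvOp, e, half_eq_C, mul_assoc (C (half A))]
  simp only [map_add, coeff_C_mul, coeff_coeffDeriv, half]
  ring

end KdVForm

/-! ### Integration constants -/

/-- `1 + ∑_{k ≥ 1} c_k ζ^k`. -/
def constSeries (c : ℕ → ℂ) : ℂ⟦X⟧ := mk fun k => if k = 0 then 1 else c k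

theorem constantCoeff_constSeries (c : ℕ → ℂ) : constantCoeff (constSeries c) = 1 := by
  rw [← coeff_zero_eq_constantCoeff_apply, constSeries, coeff_mk, if_pos rfl]

theorem coeff_succ_constSeries (c : ℕ → ℂ) (k : ℕ) : coeff (k + 1) (constSeries c) = c (k + 1) := by
  rw [constSeries, coeff_mk, if_neg k.succ_ne_zero]

theorem constSeries_zero : constSeries 0 = 1 := by
  ext n
  simp [constSeries, coeff_one]

theorem eq_one_of_sq_eq_one {Φ : ℂ⟦X⟧} (h : constantCoeff Φ = 1) (h2 : Φ ^ 2 = 1) : Φ = 1 := by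
  rcases sq_eq_one_iff.1 h2 with h3 | h3
  · exact h3
  · rw [h3] at h; norm_num at h

/-! ### KdV: homogeneous series, truncation, and the formula -/

namespace KdV

/-- Times the constant series, the solution of form 1 satisfies the recursion and has the `c j` as
constant terms. These two properties characterise the recursively defined coefficients. -/
theorem exists_hat : ∃ Φ : (DiffPoly (Fin 1))⟦X⟧, constantCoeff Φ = 1 ∧
    kdvForm (dxDer (Fin 1)) V Φ = 1 ∧
    ∀ c j, f c j = coeff j (map (algebraMap ℂ (DiffPoly (Fin 1))) (constSeries c) * Φ) := by
  obtain ⟨Φ, h0, h1⟩ := exists_kdvForm_eq_one (dxDer (Fin 1)) V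
  refine ⟨Φ, h0, h1, fun c => ?_⟩
  have hrec := coeffDeriv_eq_of_kdvForm h0 (by rw [h1]; exact Derivation.map_one_eq_zero _)
  -- Taking constant terms kills V and everything in the range of ∂, so the quadratic equation
  -- reduces to Φ² = 1.
  have hε : map (MvPolynomial.constantCoeff : DiffPoly (Fin 1) →+* ℂ) Φ = 1 := by
    refine eq_one_of_sq_eq_one (constantCoeff_map_eq_one _ h0) ?_
    have hd : ∀ Ψ : (DiffPoly (Fin 1))⟦X⟧,
        map MvPolynomial.constantCoeff (coeffDeriv (dxDer (Fin 1)) Ψ) = 0 := fun Ψ => by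
      ext n
      simp [constantCoeff_dxDer]
    have := congrArg (map (MvPolynomial.constantCoeff : DiffPoly (Fin 1) →+* ℂ)) h1
    simpa [kdvForm, hd, V] using this
  set s := map (algebraMap ℂ (DiffPoly (Fin 1))) (constSeries c) with hs
  have hs0 : coeffDeriv (dxDer (Fin 1)) s = 0 := coeffDeriv_map_algebraMap _ _
  have hrec' : coeffDeriv (dxDer (Fin 1)) (s * Φ) = X * kdvOp (dxDer (Fin 1)) V (s * Φ) := by
    rw [kdvOp_mul _ _ hs0, Derivation.leibniz, hs0, hrec]
    simp only [smul_eq_mul]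
    ring
  have hε' : map (MvPolynomial.constantCoeff : DiffPoly (Fin 1) →+* ℂ) (s * Φ) = constSeries c := by
    rw [map_mul, hε, mul_one, hs]
    ext n
    simp
  intro j
  induction j with
  | zero =>
    rw [coeff_zero_eq_constantCoeff_apply, map_mul, h0, mul_one, hs,
      constantCoeff_map_eq_one _ (constantCoeff_constSeries c)]
    rfl
  | succ j ih =>
    -- This exhibits an antiderivative of the integrand; its constant term, computed next, is `c (j
    -- + 1)`.
    have h2 := congrArg (coeff (j + 1)) hrec'
    rw [coeff_coeffDeriv, coeff_succ_X_mul, coeff_kdvOp, ← ih] at h2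
    have h3 := congrArg (coeff (j + 1)) hε'
    rw [coeff_map, coeff_succ_constSeries] at h3
    rw [f]
    simp only [dx_apply]
    rw [← MvPolynomial.algebraMap_eq, integral_dx_eq h2, h3, MvPolynomial.algebraMap_eq,
      sub_add_cancel]

/-- `∑ f_j ζ^j` for a smooth potential. -/
def fSeries (W : Smooth) (c : ℕ → ℂ) : Smooth⟦X⟧ := mk fun j => evalDiff (fun _ => W) (f c j)

theorem coe_coeff_fSeries (W : Smooth) (c : ℕ → ℂ) (j : ℕ) :
    (coeff j (fSeries W c)).1 = fAt W.1 c j := by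
  rw [fSeries, coeff_mk, coe_evalDiff']
  rfl

theorem fSeries_zero_spec (W : Smooth) : constantCoeff (fSeries W 0) = 1 ∧
    kdvForm Smooth.der W (fSeries W 0) = 1 := by
  obtain ⟨Φ, h0, h1, h2⟩ := exists_hat
  have h3 : fSeries W 0 = map (evalDiff fun _ : Fin 1 => W : DiffPoly (Fin 1) →ₐ[ℂ] Smooth).toRingHom Φ := by
    ext1 j
    rw [fSeries, coeff_mk, h2, constSeries_zero, map_one, one_mul, coeff_map]
    rfl
  refine ⟨?_, ?_⟩
  · rw [h3, constantCoeff_map_eq_one _ h0]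
  · have := map_kdvForm (e := evalDiff (fun _ : Fin 1 => W)) (evalDiff_dxDer _) V Φ
    rw [h1, map_one] at this
    rw [h3, this, V, evalDiff, MvPolynomial.aeval_X]
    rfl

theorem fSeries_eq (W : Smooth) (c : ℕ → ℂ) :
    fSeries W c = map (algebraMap ℂ Smooth) (constSeries c) * fSeries W 0 := by
  obtain ⟨Φ, h0, h1, h2⟩ := exists_hat
  have h3 : ∀ c, fSeries W c = map (evalDiff fun _ : Fin 1 => W : DiffPoly (Fin 1) →ₐ[ℂ] Smooth).toRingHom
      (map (algebraMap ℂ (DiffPoly (Fin 1))) (constSeries c) * Φ) := fun c => by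
    ext1 j
    rw [fSeries, coeff_mk, h2, coeff_map]
    rfl
  rw [h3 c, h3 0, constSeries_zero, map_one, one_mul, map_mul]
  congr 1
  ext1 j
  simp

theorem constantCoeff_fSeries (W : Smooth) (c : ℕ → ℂ) : constantCoeff (fSeries W c) = 1 := by
  rw [fSeries_eq, map_mul, (fSeries_zero_spec W).1, mul_one,
    constantCoeff_map_eq_one _ (constantCoeff_constSeries c)]

theorem coeffDeriv_kdvForm_fSeries (W : Smooth) (c : ℕ → ℂ) :
    coeffDeriv Smooth.der (kdvForm Smooth.der W (fSeries W c)) = 0 := by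
  rw [fSeries_eq, kdvForm_mul _ _ (coeffDeriv_map_algebraMap _ _), (fSeries_zero_spec W).2, mul_one,
    ← map_pow, coeffDeriv_map_algebraMap]

theorem coeffDeriv_fSeries (W : Smooth) (c : ℕ → ℂ) :
    coeffDeriv Smooth.der (fSeries W c) = X * kdvOp Smooth.der W (fSeries W c) :=
  coeffDeriv_eq_of_kdvForm (constantCoeff_fSeries W c) (coeffDeriv_kdvForm_fSeries W c)

/-- A solution of the quadratic equation with constant right-hand side `∏ (1 - E_m ζ)` is the
homogeneous solution up to the factor `∑ c_k(E) ζ^k`. -/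
theorem fSeries_zero_eq {W : Smooth} {Φ : Smooth⟦X⟧} {M : ℕ} {E : Fin M → ℂ}
    (h0 : constantCoeff Φ = 1)
    (h : kdvForm Smooth.der W Φ = map (algebraMap ℂ Smooth) (rootSeries E)) :
    fSeries W 0 = map (algebraMap ℂ Smooth) (cSeries E) * Φ := by
  refine kdvForm_eq_one_unique Smooth.der W (fSeries_zero_spec W).1 (fSeries_zero_spec W).2 ?_ ?_
  · rw [map_mul, h0, mul_one, constantCoeff_map_eq_one _ (constantCoeff_cSeries E)]
  · rw [kdvForm_mul _ _ (coeffDeriv_map_algebraMap _ _), h, ← map_pow, ← map_mul, cSeries_sq_mul,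
      map_one]

theorem fAt_zero_eq {W : Smooth} {Φ : Smooth⟦X⟧} {M : ℕ} {E : Fin M → ℂ}
    (h0 : constantCoeff Φ = 1)
    (h : kdvForm Smooth.der W Φ = map (algebraMap ℂ Smooth) (rootSeries E)) (j : ℕ) (x : ℝ) :
    fAt W.1 0 j x = coeff j (cSeries E * map (Smooth.evalAt x : Smooth →+* ℂ) Φ) := by
  have h1 := congrArg (map (Smooth.evalAt x : Smooth →+* ℂ)) (fSeries_zero_eq h0 h)
  rw [map_mul, Smooth.map_evalAt_map_algebraMap] at h1
  rw [← h1, coeff_map, ← coe_coeff_fSeries]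
  rfl

/-- `∑_{j ≤ g} f_j ζ^j`. -/
def truncSeries (W : Smooth) (c : ℕ → ℂ) (g : ℕ) : Smooth⟦X⟧ :=
  mk fun j => if j ≤ g then coeff j (fSeries W c) else 0

/-- Truncation affects the recursion only at order `g + 1`. There the left side is 0 and the right
side is f_{g+1,x}, which vanishes by stationarity. -/
theorem coeffDeriv_truncSeries {W : Smooth} {c : ℕ → ℂ} {g : ℕ} (h : IsStationary W.1 c g) :
    coeffDeriv Smooth.der (truncSeries W c g) = X * kdvOp Smooth.der W (truncSeries W c g) := by
  have hrec : ∀ j, Smooth.der (coeff (j + 1) (fSeries W c))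
      = coeff j (kdvOp Smooth.der W (fSeries W c)) := fun j => by
    rw [← coeff_coeffDeriv, coeffDeriv_fSeries, coeff_succ_X_mul]
  have hlast : Smooth.der (coeff (g + 1) (fSeries W c)) = 0 := by
    refine Smooth.ext_evalAt fun x => ?_
    rw [Smooth.coe_der, coe_coeff_fSeries]
    exact h x
  ext1 j
  cases j with
  | zero =>
    rw [coeff_zero_X_mul, coeff_coeffDeriv, truncSeries, coeff_mk, if_pos (Nat.zero_le g),
      coeff_zero_eq_constantCoeff_apply, constantCoeff_fSeries, Derivation.map_one_eq_zero]
  | succ j =>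
    rw [coeff_succ_X_mul, coeff_coeffDeriv, coeff_kdvOp, truncSeries, coeff_mk, coeff_mk]
    split_ifs with h1 h2
    · rw [hrec, coeff_kdvOp]
    · omega
    · obtain rfl : j = g := by omega
      rw [map_zero, ← coeff_kdvOp, ← hrec, hlast]
    · simp

theorem map_evalAt_truncSeries (W : Smooth) (c : ℕ → ℂ) (g : ℕ) (x : ℝ) :
    map (Smooth.evalAt x : Smooth →+* ℂ) (truncSeries W c g) = revSeries g (F W.1 c g x) := by
  ext j
  rw [coeff_map, F, coeff_revSeries_zPoly, truncSeries, coeff_mk, ← coe_coeff_fSeries]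
  split_ifs
  · rfl
  · simp

theorem map_evalAt_coeffDeriv_truncSeries (W : Smooth) (c : ℕ → ℂ) (g : ℕ) (x : ℝ) :
    map (Smooth.evalAt x : Smooth →+* ℂ) (coeffDeriv Smooth.der (truncSeries W c g))
      = revSeries g (Fx W.1 c g x) := by
  ext j
  rw [coeff_map, Fx, coeff_revSeries_zPoly, coeff_coeffDeriv, truncSeries, coeff_mk,
    ← coe_coeff_fSeries]
  split_ifs
  · rfl
  · simp

theorem map_evalAt_coeffDeriv_coeffDeriv_truncSeries (W : Smooth) (c : ℕ → ℂ) (g : ℕ) (x : ℝ) :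
    map (Smooth.evalAt x : Smooth →+* ℂ)
        (coeffDeriv Smooth.der (coeffDeriv Smooth.der (truncSeries W c g)))
      = revSeries g (Fxx W.1 c g x) := by
  ext j
  rw [coeff_map, Fxx, coeff_revSeries_zPoly, coeff_coeffDeriv, coeff_coeffDeriv, truncSeries,
    coeff_mk, ← coe_coeff_fSeries]
  split_ifs
  · rfl
  · simp

/-- Only zF² reaches degree 2g + 1. The other terms have degree at most 2g, and reversal gives them
the factor ζ of the form. -/
theorem map_evalAt_kdvForm_truncSeries (W : Smooth) (c : ℕ → ℂ) (g : ℕ) (x : ℝ) :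
    map (Smooth.evalAt x : Smooth →+* ℂ) (kdvForm Smooth.der W (truncSeries W c g))
      = revSeries (2 * g + 1) (R W.1 c g x) := by
  have d0 : (F W.1 c g x).natDegree ≤ g := natDegree_zPoly_le _ _
  have d1 : (Fx W.1 c g x).natDegree ≤ g := natDegree_zPoly_le _ _
  have d2 : (Fxx W.1 c g x).natDegree ≤ g := natDegree_zPoly_le _ _
  have dd : ∀ {P Q : Polynomial ℂ}, P.natDegree ≤ g → Q.natDegree ≤ g →
      (P * Q).natDegree ≤ g + g := fun hP hQ => Polynomial.natDegree_mul_le_of_le hP hQ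
  have hR : R W.1 c g x = Polynomial.C (1 / 2) * (Fxx W.1 c g x * F W.1 c g x)
      - Polynomial.C (1 / 4) * (Fx W.1 c g x * Fx W.1 c g x)
      - Polynomial.C (W.1 x) * (F W.1 c g x * F W.1 c g x)
      + Polynomial.X ^ 1 * (F W.1 c g x * F W.1 c g x) := by
    rw [R]; ring
  rw [show 2 * g + 1 = 1 + (g + g) by ring, hR, revSeries_add, revSeries_sub, revSeries_sub,
    revSeries_C_mul, revSeries_C_mul, revSeries_C_mul, revSeries_of_natDegree_le (dd d2 d0),
    revSeries_of_natDegree_le (dd d1 d1), revSeries_of_natDegree_le (dd d0 d0),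
    revSeries_X_pow_mul (dd d0 d0), revSeries_mul d2 d0, revSeries_mul d1 d1, revSeries_mul d0 d0,
    ← map_evalAt_truncSeries, ← map_evalAt_coeffDeriv_truncSeries,
    ← map_evalAt_coeffDeriv_coeffDeriv_truncSeries, kdvForm]
  simp only [map_add, map_mul, map_sub, map_pow, map_X, map_C, map_half]
  have h4 : (C (1 / 4 : ℂ) : ℂ⟦X⟧) = half ℂ⟦X⟧ ^ 2 := by
    rw [half_eq_C, half, ← map_pow, ← map_pow]; norm_num
  have h2 : (C (1 / 2 : ℂ) : ℂ⟦X⟧) = half ℂ⟦X⟧ := rfl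
  have hW : (Smooth.evalAt x : Smooth →+* ℂ) W = W.1 x := rfl
  rw [h4, h2, hW]
  ring

theorem hat_formula (g : ℕ) (c : ℕ → ℂ) (W : Smooth) (E : Fin (2 * g + 1) → ℂ) (x₀ : ℝ)
    (hst : IsStationary W.1 c g) (hR : R W.1 c g x₀ = rootPoly E) (x : ℝ)
    (μ : Fin g → ℂ) (hF : F W.1 c g x = rootPoly μ) (j : ℕ) :
    fHat W.1 j x = ∑ k ∈ Finset.range (min j g + 1), cCoeff (j - k) E * Psi k μ := by
  have h0 : constantCoeff (truncSeries W c g) = 1 := by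
    rw [← coeff_zero_eq_constantCoeff_apply, truncSeries, coeff_mk, if_pos (Nat.zero_le g),
      coeff_zero_eq_constantCoeff_apply, constantCoeff_fSeries]
  have h1 : kdvForm Smooth.der W (truncSeries W c g)
      = map (algebraMap ℂ Smooth) (rootSeries E) := by
    rw [← revSeries_rootPoly, ← hR, ← map_evalAt_kdvForm_truncSeries W c g x₀]
    refine Smooth.eq_map_of_coeffDeriv_eq_zero ?_ x₀
    rw [coeffDeriv_kdvForm, coeffDeriv_truncSeries hst, sub_self, mul_zero]
  rw [← coeff_cSeries_mul_rootSeries', ← revSeries_rootPoly μ, ← hF,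
    ← map_evalAt_truncSeries W c g x]
  exact fAt_zero_eq h0 h1 j x

end KdV

/-! ### The AKNS system -/

section AknsSystem

variable {A B : Type*} [CommRing A] [Algebra ℂ A] [CommRing B] [Algebra ℂ B]

/-- The constant `i`. -/
def imag (A : Type*) [CommRing A] [Algebra ℂ A] : A := algebraMap ℂ A Complex.I

theorem imag_sq (A : Type*) [CommRing A] [Algebra ℂ A] : imag A ^ 2 = -1 := by
  rw [imag, ← map_pow, Complex.I_sq, map_neg, map_one]

@[simp] theorem coeffDeriv_imag (D : Derivation ℂ A A) : coeffDeriv D (imag A⟦X⟧) = 0 :=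
  Derivation.map_algebraMap _ _

theorem imag_eq_C (A : Type*) [CommRing A] [Algebra ℂ A] : imag A⟦X⟧ = C (imag A) :=
  PowerSeries.algebraMap_apply

@[simp] theorem map_imag (e : A →ₐ[ℂ] B) : map (e : A →+* B) (imag A⟦X⟧) = imag B⟦X⟧ := by
  rw [imag_eq_C, imag_eq_C, map_C, imag, imag]
  simp

/-- The generating functions `F, G, H` of the AKNS coefficients, normalised by
`G² - ζ² F H = r`. -/
structure IsAknsSolution (D : Derivation ℂ A A) (p q : A) (F G H r : A⟦X⟧) : Prop where
  eq_f : F = -imag _ * C q * G + half _ * imag _ * (X * coeffDeriv D F)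
  eq_h : H = imag _ * C p * G - half _ * imag _ * (X * coeffDeriv D H)
  eq_g : G ^ 2 - X ^ 2 * (F * H) = r

/-- In ζ(FH)' the two terms 2iFH cancel, and what remains is divisible by 2G. -/
theorem IsAknsSolution.coeffDeriv_form {D : Derivation ℂ A A} {p q : A} {F G H r : A⟦X⟧}
    (h : IsAknsSolution D p q F G H r) :
    coeffDeriv D r = 2 * G * (coeffDeriv D G - X * (C p * F + C q * H)) := by
  rw [← h.eq_g]
  -- The relation `eq_f`, solved for ζF' by means of i² = -1.
  have e1 : X * coeffDeriv D F = -2 * imag _ * F + 2 * C q * G := by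
    linear_combination (2 * imag _) * h.eq_f + (2 * half _ * (X * coeffDeriv D F) - 2 * C q * G)
      * imag_sq A⟦X⟧ - (X * coeffDeriv D F) * two_mul_half A⟦X⟧
  have e2 : X * coeffDeriv D H = 2 * imag _ * H + 2 * C p * G := by
    linear_combination (-2 * imag _) * h.eq_h + (2 * half _ * (X * coeffDeriv D H) - 2 * C p * G)
      * imag_sq A⟦X⟧ - (X * coeffDeriv D H) * two_mul_half A⟦X⟧
  simp only [map_sub, Derivation.leibniz, Derivation.leibniz_pow, smul_eq_mul, coeffDeriv_X,
    nsmul_eq_mul]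
  push_cast
  linear_combination (-X * H) * e1 - X * F * e2

theorem IsAknsSolution.mul {D : Derivation ℂ A A} {p q : A} {F G H r s : A⟦X⟧}
    (h : IsAknsSolution D p q F G H r) (hs : coeffDeriv D s = 0) :
    IsAknsSolution D p q (s * F) (s * G) (s * H) (s ^ 2 * r) := by
  constructor
  · simp only [Derivation.leibniz, smul_eq_mul, hs, mul_zero, add_zero]
    linear_combination s * h.eq_f
  · simp only [Derivation.leibniz, smul_eq_mul, hs, mul_zero, add_zero]
    linear_combination s * h.eq_h
  · linear_combination s ^ 2 * h.eq_g

theorem IsAknsSolution.map {D : Derivation ℂ A A} {D' : Derivation ℂ B B} {p q : A}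
    {F G H r : A⟦X⟧} (h : IsAknsSolution D p q F G H r) (e : A →ₐ[ℂ] B)
    (he : ∀ a, e (D a) = D' (e a)) :
    IsAknsSolution D' (e p) (e q) (PowerSeries.map (e : A →+* B) F)
      (PowerSeries.map (e : A →+* B) G) (PowerSeries.map (e : A →+* B) H)
      (PowerSeries.map (e : A →+* B) r) := by
  have hd := map_coeffDeriv (D := D) (D' := D') (e := (e : A →+* B)) he
  constructor
  · have := congrArg (PowerSeries.map (e : A →+* B)) h.eq_f
    simpa only [map_add, map_mul, map_neg, hd, map_X, map_C, map_half, map_imag, RingHom.coe_coe] using this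
  · have := congrArg (PowerSeries.map (e : A →+* B)) h.eq_h
    simpa only [map_sub, map_mul, map_neg, hd, map_X, map_C, map_half, map_imag, RingHom.coe_coe] using this
  · rw [← h.eq_g]
    simp only [map_sub, map_mul, map_pow, map_X]

/-- The map whose fixed points are the triples `(F, H, K)` such that `F`, `G = 1 + ζ K`, `H` is a
solution normalised by `1`. -/
def aknsMap (D : Derivation ℂ A A) (p q : A) (Y : Fin 3 → A⟦X⟧) : Fin 3 → A⟦X⟧ :=
  ![-imag _ * C q * (1 + X * Y 2) + half _ * imag _ * (X * coeffDeriv D (Y 0)),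
    imag _ * C p * (1 + X * Y 2) - half _ * imag _ * (X * coeffDeriv D (Y 1)),
    half _ * (X * (Y 0 * Y 1) - X * Y 2 ^ 2)]

theorem aknsMap_isContraction (D : Derivation ℂ A A) (p q : A) : IsContraction (aknsMap D p q) := by
  intro n Y Z h i
  obtain ⟨a, ha⟩ := h 0
  obtain ⟨b, hb⟩ := h 1
  obtain ⟨k, hk⟩ := h 2
  obtain ⟨a', ha'⟩ := X_pow_dvd_coeffDeriv_sub D (h 0)
  obtain ⟨b', hb'⟩ := X_pow_dvd_coeffDeriv_sub D (h 1)
  have h0 : X ^ (n + 1) ∣ aknsMap D p q Y 0 - aknsMap D p q Z 0 := by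
    refine ⟨-imag _ * C q * k + half _ * imag _ * a', ?_⟩
    simp only [aknsMap, Matrix.cons_val]
    linear_combination (-imag _ * C q * X) * hk + half _ * imag _ * X * ha'
  have h1 : X ^ (n + 1) ∣ aknsMap D p q Y 1 - aknsMap D p q Z 1 := by
    refine ⟨imag _ * C p * k - half _ * imag _ * b', ?_⟩
    simp only [aknsMap, Matrix.cons_val]
    linear_combination (imag _ * C p * X) * hk - half _ * imag _ * X * hb'
  have h2 : X ^ (n + 1) ∣ aknsMap D p q Y 2 - aknsMap D p q Z 2 := by
    refine ⟨half _ * (Y 0 * b + Z 1 * a - (Y 2 + Z 2) * k), ?_⟩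
    simp only [aknsMap, Matrix.cons_val]
    linear_combination half _ * X * (Y 0 * hb + Z 1 * ha - (Y 2 + Z 2) * hk)
  fin_cases i <;> assumption

/-- The linear relations already give F and H in fixed-point form. With G = 1 + ζK the normalisation
is divisible by ζ and can be solved for its linear term 2K. -/
theorem isAknsSolution_one_iff {D : Derivation ℂ A A} {p q : A} {F H K : A⟦X⟧} :
    IsAknsSolution D p q F (1 + X * K) H 1 ↔ aknsMap D p q ![F, H, K] = ![F, H, K] := by
  have h2 := two_mul_half A⟦X⟧
  constructor
  · intro h
    have hK : X * (2 * K + X * K ^ 2 - X * (F * H)) = X * 0 := by linear_combination h.eq_g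
    have hK' := X_mul_cancel hK
    funext i
    fin_cases i
    · simpa [aknsMap] using h.eq_f.symm
    · simpa [aknsMap] using h.eq_h.symm
    · simp only [aknsMap, Fin.reduceFinMk, Matrix.cons_val]
      linear_combination K * h2 - half _ * hK'
  · intro h
    have e0 := congrFun h 0
    have e1 := congrFun h 1
    have e2 := congrFun h 2
    simp only [aknsMap, Matrix.cons_val] at e0 e1 e2
    refine ⟨e0.symm, e1.symm, ?_⟩
    linear_combination -2 * X * e2 + X * (X * (F * H) - X * K ^ 2) * h2

theorem exists_isAknsSolution_one (D : Derivation ℂ A A) (p q : A) :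
    ∃ F G H : A⟦X⟧, constantCoeff G = 1 ∧ IsAknsSolution D p q F G H 1 := by
  obtain ⟨Y, hY⟩ := (aknsMap_isContraction D p q).exists_fixedPoint
  have e : Y = ![Y 0, Y 1, Y 2] := by
    funext i
    fin_cases i <;> rfl
  rw [e] at hY
  exact ⟨Y 0, 1 + X * Y 2, Y 1, by simp, isAknsSolution_one_iff.2 hY⟩

/-- Uniqueness holds for the whole triple, without dividing by `p` or `q`, which may have zeros. -/
theorem IsAknsSolution.unique {D : Derivation ℂ A A} {p q : A} {F G H F' G' H' : A⟦X⟧}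
    (hG : constantCoeff G = 1) (h : IsAknsSolution D p q F G H 1)
    (hG' : constantCoeff G' = 1) (h' : IsAknsSolution D p q F' G' H' 1) : F = F' ∧ H = H' := by
  obtain ⟨K, rfl⟩ := exists_eq_one_add_X_mul hG
  obtain ⟨K', rfl⟩ := exists_eq_one_add_X_mul hG'
  have := (aknsMap_isContraction D p q).fixedPoint_unique (isAknsSolution_one_iff.1 h)
    (isAknsSolution_one_iff.1 h')
  exact ⟨congrFun this 0, congrFun this 1⟩

theorem IsAknsSolution.coeffDeriv_eq {D : Derivation ℂ A A} {p q : A} {F G H r : A⟦X⟧}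
    (h : IsAknsSolution D p q F G H r) (hG : constantCoeff G = 1) (hr : coeffDeriv D r = 0) :
    coeffDeriv D G = X * (C p * F + C q * H) := by
  have h1 := h.coeffDeriv_form
  rw [hr] at h1
  have hu := (isUnit_two A⟦X⟧).mul (isUnit_of_constantCoeff_eq_one hG)
  exact sub_eq_zero.1 ((hu.mul_right_eq_zero).1 h1.symm)

/-- The linear equations may be checked coefficientwise. -/
theorem IsAknsSolution.of_coeff {D : Derivation ℂ A A} {p q : A} {F G H : A⟦X⟧}
    (f0 : coeff 0 F = -imag A * q * coeff 0 G)
    (f1 : ∀ l, coeff (l + 1) F = -imag A * q * coeff (l + 1) G + half A * imag A * D (coeff l F))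
    (h0 : coeff 0 H = imag A * p * coeff 0 G)
    (h1 : ∀ l, coeff (l + 1) H = imag A * p * coeff (l + 1) G - half A * imag A * D (coeff l H)) :
    IsAknsSolution D p q F G H (G ^ 2 - X ^ 2 * (F * H)) := by
  refine ⟨?_, ?_, rfl⟩
  · ext1 l
    rw [half_eq_C, imag_eq_C, ← map_mul, ← map_neg, ← map_mul, map_add, coeff_C_mul, coeff_C_mul]
    cases l with
    | zero => rw [f0, coeff_zero_X_mul, mul_zero, add_zero]
    | succ l => rw [f1, coeff_succ_X_mul, coeff_coeffDeriv]
  · ext1 l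
    rw [half_eq_C, imag_eq_C, ← map_mul, ← map_mul, map_sub, coeff_C_mul, coeff_C_mul]
    cases l with
    | zero => rw [h0, coeff_zero_X_mul, mul_zero, sub_zero]
    | succ l => rw [h1, coeff_succ_X_mul, coeff_coeffDeriv]

theorem IsAknsSolution.coeff_f_zero {D : Derivation ℂ A A} {p q : A} {F G H r : A⟦X⟧}
    (h : IsAknsSolution D p q F G H r) : coeff 0 F = -imag A * q * coeff 0 G := by
  have := congrArg (coeff 0) h.eq_f
  rwa [half_eq_C, imag_eq_C, ← map_mul, ← map_neg, ← map_mul, map_add, coeff_C_mul, coeff_C_mul,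
    coeff_zero_X_mul, mul_zero, add_zero] at this

theorem IsAknsSolution.coeff_h_zero {D : Derivation ℂ A A} {p q : A} {F G H r : A⟦X⟧}
    (h : IsAknsSolution D p q F G H r) : coeff 0 H = imag A * p * coeff 0 G := by
  have := congrArg (coeff 0) h.eq_h
  rwa [half_eq_C, imag_eq_C, ← map_mul, ← map_mul, map_sub, coeff_C_mul, coeff_C_mul,
    coeff_zero_X_mul, mul_zero, sub_zero] at this

theorem IsAknsSolution.coeff_f_succ {D : Derivation ℂ A A} {p q : A} {F G H r : A⟦X⟧}
    (h : IsAknsSolution D p q F G H r) (l : ℕ) :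
    coeff (l + 1) F = -imag A * q * coeff (l + 1) G + half A * imag A * D (coeff l F) := by
  have := congrArg (coeff (l + 1)) h.eq_f
  rwa [half_eq_C, imag_eq_C, ← map_mul, ← map_neg, ← map_mul, map_add, coeff_C_mul, coeff_C_mul,
    coeff_succ_X_mul, coeff_coeffDeriv] at this

theorem IsAknsSolution.coeff_h_succ {D : Derivation ℂ A A} {p q : A} {F G H r : A⟦X⟧}
    (h : IsAknsSolution D p q F G H r) (l : ℕ) :
    coeff (l + 1) H = imag A * p * coeff (l + 1) G - half A * imag A * D (coeff l H) := by
  have := congrArg (coeff (l + 1)) h.eq_h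
  rwa [half_eq_C, imag_eq_C, ← map_mul, ← map_mul, map_sub, coeff_C_mul, coeff_C_mul,
    coeff_succ_X_mul, coeff_coeffDeriv] at this

theorem coeff_succ_coeffDeriv_akns {D : Derivation ℂ A A} {p q : A} {F G H : A⟦X⟧}
    (h : coeffDeriv D G = X * (C p * F + C q * H)) (l : ℕ) :
    D (coeff (l + 1) G) = p * coeff l F + q * coeff l H := by
  rw [← coeff_coeffDeriv, h, coeff_succ_X_mul, map_add, coeff_C_mul, coeff_C_mul]

end AknsSystem
/-- The part of order at most `n` of a power series. -/
def cut {A : Type*} [CommRing A] (n : ℕ) (a : A⟦X⟧) : A⟦X⟧ :=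
  mk fun l => if l ≤ n then coeff l a else 0

theorem coeff_cut {A : Type*} [CommRing A] (n : ℕ) (a : A⟦X⟧) (l : ℕ) :
    coeff l (cut n a) = if l ≤ n then coeff l a else 0 := coeff_mk _ _

/-! ### AKNS: homogeneous series, truncation, and the formulas -/

namespace AKNS

theorem exists_hat : ∃ F G H : (DiffPoly (Fin 2))⟦X⟧, constantCoeff G = 1 ∧
    IsAknsSolution (dxDer (Fin 2)) p q F G H 1 ∧
    ∀ c l, (fh c l).1 = coeff l (map (algebraMap ℂ (DiffPoly (Fin 2))) (constSeries c) * F) ∧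
      (fh c l).2 = coeff l (map (algebraMap ℂ (DiffPoly (Fin 2))) (constSeries c) * H) ∧
      gPoly c l = coeff l (map (algebraMap ℂ (DiffPoly (Fin 2))) (constSeries c) * G) := by
  obtain ⟨F, G, H, h0, h1⟩ := exists_isAknsSolution_one (dxDer (Fin 2)) p q
  refine ⟨F, G, H, h0, h1, fun c => ?_⟩
  -- Setting `p`, `q` and their derivatives to zero kills F by `eq_f`, so the normalisation becomes
  -- G² = 1.
  have hε : map (MvPolynomial.constantCoeff : DiffPoly (Fin 2) →+* ℂ) G = 1 := by
    refine eq_one_of_sq_eq_one (constantCoeff_map_eq_one _ h0) ?_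
    have hd : ∀ Ψ : (DiffPoly (Fin 2))⟦X⟧,
        map MvPolynomial.constantCoeff (coeffDeriv (dxDer (Fin 2)) Ψ) = 0 := fun Ψ => by
      ext n
      simp [constantCoeff_dxDer]
    have e1 := congrArg (map (MvPolynomial.constantCoeff : DiffPoly (Fin 2) →+* ℂ)) h1.eq_f
    have e2 := congrArg (map (MvPolynomial.constantCoeff : DiffPoly (Fin 2) →+* ℂ)) h1.eq_g
    simp only [map_add, map_mul, map_neg, hd, map_C, q, MvPolynomial.constantCoeff_X, map_zero,
      mul_zero, zero_mul, add_zero] at e1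
    simpa [e1] using e2
  set s := map (algebraMap ℂ (DiffPoly (Fin 2))) (constSeries c) with hs
  have hs0 : coeffDeriv (dxDer (Fin 2)) s = 0 := coeffDeriv_map_algebraMap _ _
  have hsol := h1.mul hs0
  have hsG : constantCoeff (s * G) = 1 := by
    rw [map_mul, h0, mul_one, hs, constantCoeff_map_eq_one _ (constantCoeff_constSeries c)]
  have hrec := coeff_succ_coeffDeriv_akns (hsol.coeffDeriv_eq hsG (by
    rw [mul_one, hs, ← map_pow, coeffDeriv_map_algebraMap]))
  have hε' : map (MvPolynomial.constantCoeff : DiffPoly (Fin 2) →+* ℂ) (s * G) = constSeries c := by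
    rw [map_mul, hε, mul_one, hs]
    ext n
    simp
  have hI : imag (DiffPoly (Fin 2)) = MvPolynomial.C Complex.I := rfl
  have hI2 : half (DiffPoly (Fin 2)) * imag (DiffPoly (Fin 2)) = MvPolynomial.C (Complex.I / 2) := by
    rw [half, imag, ← map_mul, MvPolynomial.algebraMap_eq]
    congr 1
    ring
  have hI3 : (MvPolynomial.C (-Complex.I / 2) : DiffPoly (Fin 2))
      = -MvPolynomial.C (Complex.I / 2) := by
    rw [neg_div, map_neg]
  intro l
  induction l with
  | zero =>
    have hg : coeff 0 (s * G) = 1 :=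
      (coeff_zero_eq_constantCoeff_apply _).trans hsG
    rw [hsol.coeff_f_zero, hsol.coeff_h_zero, hg]
    refine ⟨?_, ?_, rfl⟩
    · rw [fh, hI, mul_one, map_neg]
    · rw [fh, hI, mul_one]
  | succ l ih =>
    have hg : gPoly c (l + 1) = coeff (l + 1) (s * G) := by
      have h3 := congrArg (coeff (l + 1)) hε'
      rw [coeff_map, coeff_succ_constSeries] at h3
      rw [gPoly, gNext, ih.1, ih.2.1, integral_dx_eq (hrec l), h3, sub_add_cancel]
    refine ⟨?_, ?_, hg⟩
    · rw [hsol.coeff_f_succ, ← hg, ← ih.1, hI2, hI, fh, gPoly]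
      simp only [dx_apply]
      ring
    · rw [hsol.coeff_h_succ, ← hg, ← ih.2.1, hI2, hI, fh, gPoly]
      simp only [dx_apply, hI3]
      ring

/-- `∑ f_l ζ^l` for smooth `p`, `q`. -/
def fSeries (p q : Smooth) (c : ℕ → ℂ) : Smooth⟦X⟧ := mk fun l => evalDiff ![p, q] (fh c l).1

/-- `∑ h_l ζ^l` for smooth `p`, `q`. -/
def hSeries (p q : Smooth) (c : ℕ → ℂ) : Smooth⟦X⟧ := mk fun l => evalDiff ![p, q] (fh c l).2

/-- `∑ g_l ζ^l` for smooth `p`, `q`. -/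
def gSeries (p q : Smooth) (c : ℕ → ℂ) : Smooth⟦X⟧ := mk fun l => evalDiff ![p, q] (gPoly c l)

theorem coe_evalDiff_pair (p q : Smooth) (P : DiffPoly (Fin 2)) :
    (evalDiff ![p, q] P).1 = DiffPoly.at ![p.1, q.1] P := by
  rw [coe_evalDiff']
  congr 1
  funext i
  fin_cases i <;> rfl

theorem coe_coeff_fSeries (p q : Smooth) (c : ℕ → ℂ) (l : ℕ) :
    (coeff l (fSeries p q c)).1 = fAt p.1 q.1 c l := by
  rw [fSeries, coeff_mk, coe_evalDiff_pair]
  rfl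

theorem coe_coeff_hSeries (p q : Smooth) (c : ℕ → ℂ) (l : ℕ) :
    (coeff l (hSeries p q c)).1 = hAt p.1 q.1 c l := by
  rw [hSeries, coeff_mk, coe_evalDiff_pair]
  rfl

theorem coe_coeff_gSeries (p q : Smooth) (c : ℕ → ℂ) (l : ℕ) :
    (coeff l (gSeries p q c)).1 = gAt p.1 q.1 c l := by
  rw [gSeries, coeff_mk, coe_evalDiff_pair]
  rfl

theorem series_spec (p q : Smooth) (c : ℕ → ℂ) : constantCoeff (gSeries p q c) = 1 ∧
    IsAknsSolution Smooth.der p q (fSeries p q c) (gSeries p q c) (hSeries p q c)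
      (map (algebraMap ℂ Smooth) (constSeries c ^ 2)) := by
  obtain ⟨F, G, H, h0, h1, h2⟩ := exists_hat
  have hs0 : coeffDeriv (dxDer (Fin 2))
      (map (algebraMap ℂ (DiffPoly (Fin 2))) (constSeries c)) = 0 := coeffDeriv_map_algebraMap _ _
  have hsol := (h1.mul hs0).map (evalDiff ![p, q]) (evalDiff_dxDer _)
  have eF : fSeries p q c = map (evalDiff ![p, q] : DiffPoly (Fin 2) →ₐ[ℂ] Smooth).toRingHom
      (map (algebraMap ℂ (DiffPoly (Fin 2))) (constSeries c) * F) := by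
    ext1 l
    rw [fSeries, coeff_mk, (h2 c l).1, coeff_map]
    rfl
  have eH : hSeries p q c = map (evalDiff ![p, q] : DiffPoly (Fin 2) →ₐ[ℂ] Smooth).toRingHom
      (map (algebraMap ℂ (DiffPoly (Fin 2))) (constSeries c) * H) := by
    ext1 l
    rw [hSeries, coeff_mk, (h2 c l).2.1, coeff_map]
    rfl
  have eG : gSeries p q c = map (evalDiff ![p, q] : DiffPoly (Fin 2) →ₐ[ℂ] Smooth).toRingHom
      (map (algebraMap ℂ (DiffPoly (Fin 2))) (constSeries c) * G) := by
    ext1 l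
    rw [gSeries, coeff_mk, (h2 c l).2.2, coeff_map]
    rfl
  have er : map (algebraMap ℂ Smooth) (constSeries c ^ 2)
      = map (evalDiff ![p, q] : DiffPoly (Fin 2) →ₐ[ℂ] Smooth).toRingHom
        (map (algebraMap ℂ (DiffPoly (Fin 2))) (constSeries c) ^ 2 * 1) := by
    rw [mul_one, ← map_pow]
    ext1 l
    rw [coeff_map, coeff_map, coeff_map]
    exact ((evalDiff ![p, q]).commutes _).symm
  have ep : (evalDiff ![p, q]) AKNS.p = p := by
    rw [AKNS.p, evalDiff, MvPolynomial.aeval_X]; rfl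
  have eq : (evalDiff ![p, q]) AKNS.q = q := by
    rw [AKNS.q, evalDiff, MvPolynomial.aeval_X]; rfl
  rw [ep, eq] at hsol
  refine ⟨?_, ?_⟩
  · rw [eG]
    refine constantCoeff_map_eq_one _ ?_
    rw [map_mul, h0, mul_one, constantCoeff_map_eq_one _ (constantCoeff_constSeries c)]
  · rw [eF, eG, eH, er]
    exact hsol

theorem coeff_stationary {p q : Smooth} {c : ℕ → ℂ} {g : ℕ} (h : IsStationary p.1 q.1 c g) :
    coeff (g + 1) (fSeries p q c) = 0 ∧ coeff (g + 1) (hSeries p q c) = 0 := by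
  refine ⟨Smooth.ext_evalAt fun x => ?_, Smooth.ext_evalAt fun x => ?_⟩
  · rw [coe_coeff_fSeries]; exact (h x).1
  · rw [coe_coeff_hSeries]; exact (h x).2

/-- G keeps one order more than F and H. At order `g + 1` the right sides are therefore the full
f_{g+1} and h_{g+1}, which stationarity sets to 0. -/
theorem cut_isAknsSolution {p q : Smooth} {c : ℕ → ℂ} {g : ℕ} (h : IsStationary p.1 q.1 c g) :
    IsAknsSolution Smooth.der p q (cut g (fSeries p q c)) (cut (g + 1) (gSeries p q c))
      (cut g (hSeries p q c)) (cut (g + 1) (gSeries p q c) ^ 2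
        - X ^ 2 * (cut g (fSeries p q c) * cut g (hSeries p q c))) := by
  obtain ⟨-, hsol⟩ := series_spec p q c
  obtain ⟨hf, hh⟩ := coeff_stationary h
  refine IsAknsSolution.of_coeff ?_ (fun l => ?_) ?_ fun l => ?_
  · simpa [coeff_cut] using hsol.coeff_f_zero
  · have := hsol.coeff_f_succ l
    simp only [coeff_cut]
    rcases lt_trichotomy l g with hl | rfl | hl
    · rw [if_pos (by omega), if_pos (by omega), if_pos (by omega), this]
    · rw [if_neg (by omega), if_pos (by omega), if_pos (by omega), ← this, hf]
    · rw [if_neg (by omega), if_neg (by omega), if_neg (by omega)]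
      simp
  · simpa [coeff_cut] using hsol.coeff_h_zero
  · have := hsol.coeff_h_succ l
    simp only [coeff_cut]
    rcases lt_trichotomy l g with hl | rfl | hl
    · rw [if_pos (by omega), if_pos (by omega), if_pos (by omega), this]
    · rw [if_neg (by omega), if_pos (by omega), if_pos (by omega), ← this, hh]
    · rw [if_neg (by omega), if_neg (by omega), if_neg (by omega)]
      simp

/-- The factor ζ matches the cut of G at `g + 1` with the cuts of F and H at `g`, so stationarity
plays no role here. -/
theorem coeffDeriv_cut_gSeries (p q : Smooth) (c : ℕ → ℂ) (g : ℕ) :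
    coeffDeriv Smooth.der (cut (g + 1) (gSeries p q c))
      = X * (C p * cut g (fSeries p q c) + C q * cut g (hSeries p q c)) := by
  obtain ⟨h0, hsol⟩ := series_spec p q c
  have hrec := coeff_succ_coeffDeriv_akns
    (hsol.coeffDeriv_eq h0 (coeffDeriv_map_algebraMap _ _))
  ext1 l
  cases l with
  | zero =>
    rw [coeff_zero_X_mul, coeff_coeffDeriv, coeff_cut, if_pos (by omega),
      coeff_zero_eq_constantCoeff_apply, h0, Derivation.map_one_eq_zero]
  | succ l =>
    rw [coeff_succ_X_mul, coeff_coeffDeriv, map_add, coeff_C_mul, coeff_C_mul, coeff_cut, coeff_cut,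
      coeff_cut]
    by_cases hl : l ≤ g
    · rw [if_pos (by omega), if_pos hl, if_pos hl, hrec]
    · rw [if_neg (by omega), if_neg hl, if_neg hl]
      simp

theorem map_evalAt_cut_fSeries (p q : Smooth) (c : ℕ → ℂ) (g : ℕ) (x : ℝ) :
    map (Smooth.evalAt x : Smooth →+* ℂ) (cut g (fSeries p q c))
      = revSeries g (F p.1 q.1 c g x) := by
  ext j
  rw [coeff_map, F, coeff_revSeries_zPoly, coeff_cut, ← coe_coeff_fSeries]
  split_ifs
  · rfl
  · simp

theorem map_evalAt_cut_hSeries (p q : Smooth) (c : ℕ → ℂ) (g : ℕ) (x : ℝ) :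
    map (Smooth.evalAt x : Smooth →+* ℂ) (cut g (hSeries p q c))
      = revSeries g (H p.1 q.1 c g x) := by
  ext j
  rw [coeff_map, H, coeff_revSeries_zPoly, coeff_cut, ← coe_coeff_hSeries]
  split_ifs
  · rfl
  · simp

theorem map_evalAt_cut_gSeries (p q : Smooth) (c : ℕ → ℂ) (g : ℕ) (x : ℝ) :
    map (Smooth.evalAt x : Smooth →+* ℂ) (cut (g + 1) (gSeries p q c))
      = revSeries (g + 1) (G p.1 q.1 c g x) := by
  ext j
  rw [coeff_map, G, coeff_revSeries_zPoly, coeff_cut, ← coe_coeff_gSeries]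
  split_ifs
  · rfl
  · simp

theorem revSeries_R (p q : Smooth) (c : ℕ → ℂ) (g : ℕ) (x : ℝ) :
    revSeries (2 * g + 2) (R p.1 q.1 c g x) = map (Smooth.evalAt x : Smooth →+* ℂ)
      (cut (g + 1) (gSeries p q c) ^ 2
        - X ^ 2 * (cut g (fSeries p q c) * cut g (hSeries p q c))) := by
  have dF : (F p.1 q.1 c g x).natDegree ≤ g := natDegree_zPoly_le _ _
  have dH : (H p.1 q.1 c g x).natDegree ≤ g := natDegree_zPoly_le _ _
  have dG : (G p.1 q.1 c g x).natDegree ≤ g + 1 := natDegree_zPoly_le _ _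
  rw [map_sub, map_mul, map_mul, map_pow, map_pow, map_X, map_evalAt_cut_fSeries,
    map_evalAt_cut_hSeries, map_evalAt_cut_gSeries, R, revSeries_sub, sq (G _ _ _ _ _)]
  rw [show 2 * g + 2 = (g + 1) + (g + 1) by ring, revSeries_mul dG dG,
    show (g + 1) + (g + 1) = 2 + (g + g) by ring,
    revSeries_of_natDegree_le (Polynomial.natDegree_mul_le_of_le dF dH), revSeries_mul dF dH]
  ring

theorem series_zero_eq {p q : Smooth} {c : ℕ → ℂ} {g : ℕ} {E : Fin (2 * g + 2) → ℂ} {x₀ : ℝ}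
    (hst : IsStationary p.1 q.1 c g) (hR : R p.1 q.1 c g x₀ = rootPoly E) :
    fSeries p q 0 = map (algebraMap ℂ Smooth) (cSeries E) * cut g (fSeries p q c) ∧
      hSeries p q 0 = map (algebraMap ℂ Smooth) (cSeries E) * cut g (hSeries p q c) := by
  have hsol := cut_isAknsSolution hst
  obtain ⟨h0, hhat⟩ := series_spec p q 0
  rw [constSeries_zero, one_pow, map_one] at hhat
  have hc : constantCoeff (cut (g + 1) (gSeries p q c)) = 1 := by
    rw [← coeff_zero_eq_constantCoeff_apply, coeff_cut, if_pos (by omega),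
      coeff_zero_eq_constantCoeff_apply, (series_spec p q c).1]
  have hform := hsol.coeffDeriv_form
  rw [coeffDeriv_cut_gSeries, sub_self, mul_zero] at hform
  have hr := Smooth.eq_map_of_coeffDeriv_eq_zero hform x₀
  rw [← revSeries_R, hR, revSeries_rootPoly] at hr
  rw [hr] at hsol
  have hs := hsol.mul (coeffDeriv_map_algebraMap Smooth.der (cSeries E))
  rw [← map_pow, ← map_mul, cSeries_sq_mul, map_one] at hs
  refine hhat.unique h0 ?_ hs
  rw [map_mul, hc, mul_one, constantCoeff_map_eq_one _ (constantCoeff_cSeries E)]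

theorem hat_formula {g : ℕ} {c : ℕ → ℂ} {p q : Smooth} {E : Fin (2 * g + 2) → ℂ} {x₀ : ℝ}
    (hst : IsStationary p.1 q.1 c g) (hR : R p.1 q.1 c g x₀ = rootPoly E) (x : ℝ) :
    (∀ μ : Fin g → ℂ, F p.1 q.1 c g x = Polynomial.C (-Complex.I * q.1 x) * rootPoly μ →
      ∀ j : ℕ, fHat p.1 q.1 j x = -Complex.I * q.1 x *
        ∑ k ∈ Finset.range (min j g + 1), cCoeff (j - k) E * Psi k μ) ∧
    (∀ ν : Fin g → ℂ, H p.1 q.1 c g x = Polynomial.C (Complex.I * p.1 x) * rootPoly ν →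
      ∀ j : ℕ, hHat p.1 q.1 j x = Complex.I * p.1 x *
        ∑ k ∈ Finset.range (min j g + 1), cCoeff (j - k) E * Psi k ν) := by
  obtain ⟨ef, eh⟩ := series_zero_eq hst hR
  refine ⟨fun μ hF j => ?_, fun ν hH j => ?_⟩
  · have h1 := congrArg (coeff j) (congrArg (map (Smooth.evalAt x : Smooth →+* ℂ)) ef)
    rw [map_mul, Smooth.map_evalAt_map_algebraMap, map_evalAt_cut_fSeries, hF, revSeries_C_mul,
      revSeries_rootPoly, mul_left_comm, coeff_C_mul, coeff_cSeries_mul_rootSeries'] at h1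
    rw [← h1, fHat, ← coe_coeff_fSeries, coeff_map]
    rfl
  · have h1 := congrArg (coeff j) (congrArg (map (Smooth.evalAt x : Smooth →+* ℂ)) eh)
    rw [map_mul, Smooth.map_evalAt_map_algebraMap, map_evalAt_cut_hSeries, hH, revSeries_C_mul,
      revSeries_rootPoly, mul_left_comm, coeff_C_mul, coeff_cSeries_mul_rootSeries'] at h1
    rw [← h1, hHat, ← coe_coeff_hSeries, coeff_map]
    rfl

end AKNS

/-! ### The Toda system -/

theorem constantCoeff_map_apply {A B : Type*} [CommRing A] [CommRing B] (e : A →+* B) (Φ : A⟦X⟧) :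
    constantCoeff (map e Φ) = e (constantCoeff Φ) := by
  rw [← coeff_zero_eq_constantCoeff_apply, coeff_map, coeff_zero_eq_constantCoeff_apply]

theorem X_pow_dvd_map_sub {A B : Type*} [CommRing A] [CommRing B] {e : A →+* B} {n : ℕ}
    {f g : A⟦X⟧} (h : X ^ n ∣ f - g) : X ^ n ∣ map e f - map e g := by
  obtain ⟨w, hw⟩ := h
  exact ⟨map e w, by rw [← map_sub, hw, map_mul, map_pow, map_X]⟩

theorem exists_eq_neg_one_add_X_mul {A : Type*} [CommRing A] {G : A⟦X⟧}
    (h : constantCoeff G = -1) : ∃ K, G = -1 + X * K := by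
  obtain ⟨K, hK⟩ := exists_eq_one_add_X_mul (Φ := -G) (by simp [h])
  exact ⟨-K, by linear_combination -hK⟩

section TodaSystem

variable {A B : Type*} [CommRing A] [Algebra ℂ A] [CommRing B] [Algebra ℂ B]

/-- The generating functions `F`, `G` of the Toda coefficients for the forward and backward shifts
`P`, `M`, normalised by `G² - 4 ζ² a² F F⁺ = r`. -/
structure IsTodaSolution (P M : A →ₐ[ℂ] A) (a b : A) (F G r : A⟦X⟧) : Prop where
  eq_f : 2 * (1 + X * C b) * F + G + map (M : A →+* A) G = 0
  eq_g : G ^ 2 - 4 * X ^ 2 * C a ^ 2 * (F * map (P : A →+* A) F) = r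

/-- Discrete counterpart of the first integral: G² - (G⁻)² splits as (G - G⁻)(G + G⁻), and `eq_f`
replaces G + G⁻ by a multiple of F. The term FF⁺ - F⁻F also contains F. -/
theorem IsTodaSolution.sub_shift {P M : A →ₐ[ℂ] A} (hMP : ∀ f, M (P f) = f) {a b : A}
    {F G r : A⟦X⟧} (h : IsTodaSolution P M a b F G r) :
    r - map (M : A →+* A) r = -2 * F * ((1 + X * C b) * (G - map (M : A →+* A) G)
      + 2 * X ^ 2 * (C a ^ 2 * map (P : A →+* A) F - C (M a) ^ 2 * map (M : A →+* A) F)) := by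
  have hF : map (M : A →+* A) (map (P : A →+* A) F) = F := by
    ext n
    simp [hMP]
  have h4 : map (M : A →+* A) (4 : A⟦X⟧) = 4 := map_ofNat _ 4
  rw [← h.eq_g]
  simp only [map_sub, map_mul, map_pow, hF, map_X, map_C, RingHom.coe_coe, h4]
  linear_combination (G - map (M : A →+* A) G) * h.eq_f

theorem IsTodaSolution.mul {P M : A →ₐ[ℂ] A} {a b : A} {F G r : A⟦X⟧}
    (h : IsTodaSolution P M a b F G r) (s : ℂ⟦X⟧) :
    IsTodaSolution P M a b (PowerSeries.map (algebraMap ℂ A) s * F)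
      (PowerSeries.map (algebraMap ℂ A) s * G) (PowerSeries.map (algebraMap ℂ A) s ^ 2 * r) := by
  have hs : ∀ e : A →ₐ[ℂ] A, PowerSeries.map (e : A →+* A) (PowerSeries.map (algebraMap ℂ A) s)
      = PowerSeries.map (algebraMap ℂ A) s := fun e => by
    ext n
    rw [coeff_map, coeff_map]
    exact e.commutes _
  constructor
  · rw [map_mul, hs]
    linear_combination PowerSeries.map (algebraMap ℂ A) s * h.eq_f
  · rw [map_mul, hs]
    linear_combination PowerSeries.map (algebraMap ℂ A) s ^ 2 * h.eq_g

theorem IsTodaSolution.map {P M : A →ₐ[ℂ] A} {P' M' : B →ₐ[ℂ] B} {a b : A} {F G r : A⟦X⟧}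
    (h : IsTodaSolution P M a b F G r) (e : A →ₐ[ℂ] B) (hP : ∀ f, e (P f) = P' (e f))
    (hM : ∀ f, e (M f) = M' (e f)) :
    IsTodaSolution P' M' (e a) (e b) (PowerSeries.map (e : A →+* B) F)
      (PowerSeries.map (e : A →+* B) G) (PowerSeries.map (e : A →+* B) r) := by
  have hP' : ∀ f : A⟦X⟧, PowerSeries.map (e : A →+* B) (PowerSeries.map (P : A →+* A) f)
      = PowerSeries.map (P' : B →+* B) (PowerSeries.map (e : A →+* B) f) := fun f => by
    ext n
    simp [hP]
  have hM' : ∀ f : A⟦X⟧, PowerSeries.map (e : A →+* B) (PowerSeries.map (M : A →+* A) f)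
      = PowerSeries.map (M' : B →+* B) (PowerSeries.map (e : A →+* B) f) := fun f => by
    ext n
    simp [hM]
  have h2 : PowerSeries.map (e : A →+* B) (2 : A⟦X⟧) = 2 := map_ofNat _ 2
  have h4 : PowerSeries.map (e : A →+* B) (4 : A⟦X⟧) = 4 := map_ofNat _ 4
  constructor
  · have := congrArg (PowerSeries.map (e : A →+* B)) h.eq_f
    simpa only [map_add, map_mul, map_one, map_zero, hM', map_X, map_C, h2, RingHom.coe_coe]
      using this
  · have := congrArg (PowerSeries.map (e : A →+* B)) h.eq_g
    simpa only [map_sub, map_mul, map_pow, hP', map_X, map_C, h4, RingHom.coe_coe] using this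

/-- The map whose fixed points are the pairs `(F, K)` such that `F`, `G = -1 + ζ K` is a solution
normalised by `1`. -/
def todaMap (P M : A →ₐ[ℂ] A) (a b : A) (Y : Fin 2 → A⟦X⟧) : Fin 2 → A⟦X⟧ :=
  ![1 - half _ * (X * (Y 1 + map (M : A →+* A) (Y 1))) - X * C b * Y 0,
    half _ * (X * Y 1 ^ 2) - 2 * X * C a ^ 2 * (Y 0 * map (P : A →+* A) (Y 0))]

theorem todaMap_isContraction (P M : A →ₐ[ℂ] A) (a b : A) :
    IsContraction (todaMap P M a b) := by
  intro n Y Z h i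
  obtain ⟨f, hf⟩ := h 0
  obtain ⟨k, hk⟩ := h 1
  obtain ⟨f', hf'⟩ := X_pow_dvd_map_sub (e := (P : A →+* A)) (h 0)
  obtain ⟨k', hk'⟩ := X_pow_dvd_map_sub (e := (M : A →+* A)) (h 1)
  have h0 : X ^ (n + 1) ∣ todaMap P M a b Y 0 - todaMap P M a b Z 0 := by
    refine ⟨-half _ * (k + k') - C b * f, ?_⟩
    simp only [todaMap, Matrix.cons_val]
    linear_combination (-half _ * X) * hk - half _ * X * hk' - X * C b * hf
  have h1 : X ^ (n + 1) ∣ todaMap P M a b Y 1 - todaMap P M a b Z 1 := by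
    refine ⟨half _ * (Y 1 + Z 1) * k
      - 2 * C a ^ 2 * (Y 0 * f' + map (P : A →+* A) (Z 0) * f), ?_⟩
    simp only [todaMap, Matrix.cons_val]
    linear_combination half _ * X * (Y 1 + Z 1) * hk - 2 * X * C a ^ 2 * Y 0 * hf'
      - 2 * X * C a ^ 2 * map (P : A →+* A) (Z 0) * hf
  fin_cases i <;> assumption

/-- With G = -1 + ζK the first relation is solved for F. The normalisation, after cancelling ζ, is
solved for its linear term -2K. -/
theorem isTodaSolution_one_iff {P M : A →ₐ[ℂ] A} {a b : A} {F K : A⟦X⟧} :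
    IsTodaSolution P M a b F (-1 + X * K) 1 ↔ todaMap P M a b ![F, K] = ![F, K] := by
  have h2 := two_mul_half A⟦X⟧
  have hG : map (M : A →+* A) (-1 + X * K) = -1 + X * map (M : A →+* A) K := by simp
  constructor
  · intro h
    have e1 := h.eq_f
    rw [hG] at e1
    have hK : X * (-2 * K + X * K ^ 2 - 4 * X * C a ^ 2 * (F * map (P : A →+* A) F)) = X * 0 := by
      linear_combination h.eq_g
    have hK' := X_mul_cancel hK
    funext i
    fin_cases i
    · simp only [todaMap, Fin.zero_eta, Matrix.cons_val]
      linear_combination (F + X * C b * F - 1) * h2 - half _ * e1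
    · simp only [todaMap, Fin.mk_one, Matrix.cons_val]
      linear_combination half _ * hK'
        + (K + 2 * X * C a ^ 2 * (F * map (P : A →+* A) F)) * h2
  · intro h
    have e0 := congrFun h 0
    have e1 := congrFun h 1
    simp only [todaMap, Matrix.cons_val] at e0 e1
    constructor
    · rw [hG]
      linear_combination -2 * e0 - X * (K + map (M : A →+* A) K) * h2
    · linear_combination 2 * X * e1 - X * (X * K ^ 2) * h2

theorem exists_isTodaSolution_one (P M : A →ₐ[ℂ] A) (a b : A) :
    ∃ F G : A⟦X⟧, constantCoeff G = -1 ∧ IsTodaSolution P M a b F G 1 := by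
  obtain ⟨Y, hY⟩ := (todaMap_isContraction P M a b).exists_fixedPoint
  have e : Y = ![Y 0, Y 1] := by
    funext i
    fin_cases i <;> rfl
  rw [e] at hY
  exact ⟨Y 0, -1 + X * Y 1, by simp, isTodaSolution_one_iff.2 hY⟩

theorem IsTodaSolution.unique {P M : A →ₐ[ℂ] A} {a b : A} {F G F' G' : A⟦X⟧}
    (hG : constantCoeff G = -1) (h : IsTodaSolution P M a b F G 1)
    (hG' : constantCoeff G' = -1) (h' : IsTodaSolution P M a b F' G' 1) : F = F' := by
  obtain ⟨K, rfl⟩ := exists_eq_neg_one_add_X_mul hG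
  obtain ⟨K', rfl⟩ := exists_eq_neg_one_add_X_mul hG'
  exact congrFun ((todaMap_isContraction P M a b).fixedPoint_unique (isTodaSolution_one_iff.1 h)
    (isTodaSolution_one_iff.1 h')) 0

theorem coeff_toda_eq_f_zero {M : A →ₐ[ℂ] A} {b : A} {F G : A⟦X⟧} :
    coeff 0 (2 * (1 + X * C b) * F + G + map (M : A →+* A) G)
      = 2 * coeff 0 F + coeff 0 G + M (coeff 0 G) := by
  have h2 : constantCoeff (2 : A⟦X⟧) = 2 := map_ofNat _ 2
  simp [constantCoeff_map_apply, h2]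

theorem coeff_toda_eq_f_succ {M : A →ₐ[ℂ] A} {b : A} {F G : A⟦X⟧} (l : ℕ) :
    coeff (l + 1) (2 * (1 + X * C b) * F + G + map (M : A →+* A) G)
      = 2 * coeff (l + 1) F + 2 * (b * coeff l F) + coeff (l + 1) G + M (coeff (l + 1) G) := by
  have e : 2 * (1 + X * C b) * F + G + map (M : A →+* A) G
      = C 2 * F + C 2 * (X * (C b * F)) + G + map (M : A →+* A) G := by
    rw [map_ofNat]; ring
  rw [e]
  simp only [map_add, coeff_C_mul, coeff_succ_X_mul, coeff_map, RingHom.coe_coe]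

theorem IsTodaSolution.coeff_f_zero {P M : A →ₐ[ℂ] A} {a b : A} {F G r : A⟦X⟧}
    (h : IsTodaSolution P M a b F G r) (hG : constantCoeff G = -1) : coeff 0 F = 1 := by
  have h1 := coeff_toda_eq_f_zero.symm.trans (congrArg (coeff 0) h.eq_f)
  rw [coeff_zero_eq_constantCoeff_apply G, hG, map_neg, map_one, map_zero] at h1
  linear_combination (1 - coeff 0 F) * two_mul_half A + half A * h1

theorem IsTodaSolution.coeff_f_succ {P M : A →ₐ[ℂ] A} {a b : A} {F G r : A⟦X⟧}
    (h : IsTodaSolution P M a b F G r) (l : ℕ) :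
    2 * coeff (l + 1) F + 2 * (b * coeff l F) + coeff (l + 1) G + M (coeff (l + 1) G) = 0 :=
  (coeff_toda_eq_f_succ l).symm.trans ((congrArg (coeff (l + 1)) h.eq_f).trans (map_zero _))

theorem coeff_toda_zero {P M : A →ₐ[ℂ] A} {a b : A} {F G : A⟦X⟧} :
    coeff 0 ((1 + X * C b) * (G - map (M : A →+* A) G)
      + 2 * X ^ 2 * (C a ^ 2 * map (P : A →+* A) F - C (M a) ^ 2 * map (M : A →+* A) F))
    = coeff 0 G - M (coeff 0 G) := by
  simp [constantCoeff_map_apply]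

theorem coeff_toda_one {P M : A →ₐ[ℂ] A} {a b : A} {F G : A⟦X⟧} :
    coeff 1 ((1 + X * C b) * (G - map (M : A →+* A) G)
      + 2 * X ^ 2 * (C a ^ 2 * map (P : A →+* A) F - C (M a) ^ 2 * map (M : A →+* A) F))
    = coeff 1 G - M (coeff 1 G) + b * (coeff 0 G - M (coeff 0 G)) := by
  have e : (1 + X * C b) * (G - map (M : A →+* A) G)
      + 2 * X ^ 2 * (C a ^ 2 * map (P : A →+* A) F - C (M a) ^ 2 * map (M : A →+* A) F)
      = (G - map (M : A →+* A) G) + X * (C b * (G - map (M : A →+* A) G)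
      + X * (2 * (C a ^ 2 * map (P : A →+* A) F - C (M a) ^ 2 * map (M : A →+* A) F))) := by ring
  have hX : ∀ f : A⟦X⟧, coeff 1 (X * f) = coeff 0 f := fun f => coeff_succ_X_mul 0 f
  rw [e, map_add, hX, map_add, coeff_zero_X_mul, coeff_C_mul, map_sub, map_sub, coeff_map,
    coeff_map, add_zero]
  rfl

theorem coeff_toda_add_two {P M : A →ₐ[ℂ] A} {a b : A} {F G : A⟦X⟧} (l : ℕ) :
    coeff (l + 2) ((1 + X * C b) * (G - map (M : A →+* A) G)
      + 2 * X ^ 2 * (C a ^ 2 * map (P : A →+* A) F - C (M a) ^ 2 * map (M : A →+* A) F))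
    = coeff (l + 2) G - M (coeff (l + 2) G) + b * (coeff (l + 1) G - M (coeff (l + 1) G))
      + 2 * (a ^ 2 * P (coeff l F) - M a ^ 2 * M (coeff l F)) := by
  have e : (1 + X * C b) * (G - map (M : A →+* A) G)
      + 2 * X ^ 2 * (C a ^ 2 * map (P : A →+* A) F - C (M a) ^ 2 * map (M : A →+* A) F)
      = (G - map (M : A →+* A) G) + X * (C b * (G - map (M : A →+* A) G)
      + X * (C 2 * (C (a ^ 2) * map (P : A →+* A) F - C (M a ^ 2) * map (M : A →+* A) F))) := by
    rw [map_ofNat, map_pow, map_pow]; ring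
  rw [e, map_add, coeff_succ_X_mul, map_add, coeff_succ_X_mul]
  simp only [coeff_C_mul, map_sub, coeff_map, RingHom.coe_coe]
  ring

theorem IsTodaSolution.difference_eq_zero {P M : A →ₐ[ℂ] A} (hMP : ∀ f, M (P f) = f) {a b : A}
    {F G r : A⟦X⟧} (h : IsTodaSolution P M a b F G r) (hG : constantCoeff G = -1)
    (hr : PowerSeries.map (M : A →+* A) r = r) :
    (1 + X * C b) * (G - PowerSeries.map (M : A →+* A) G) + 2 * X ^ 2 *
      (C a ^ 2 * PowerSeries.map (P : A →+* A) F - C (M a) ^ 2 * PowerSeries.map (M : A →+* A) F)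
      = 0 := by
  have h1 := h.sub_shift hMP
  rw [hr, sub_self] at h1
  have hF : constantCoeff F = 1 := by
    rw [← coeff_zero_eq_constantCoeff_apply, h.coeff_f_zero hG]
  have hu : IsUnit (-2 * F) :=
    (isUnit_two A⟦X⟧).neg.mul (isUnit_of_constantCoeff_eq_one hF)
  exact (hu.mul_right_eq_zero).1 h1.symm

end TodaSystem

/-! ### Toda: homogeneous series, truncation, and the formula -/

namespace Toda

theorem shift_neg_shift {ι : Type} (f : DiffcePoly ι) : shift (-1) (shift 1 f) = f := by
  rw [shift, shift, MvPolynomial.rename_rename]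
  have : ((fun v : ι × ℤ => (v.1, v.2 + -1)) ∘ fun v : ι × ℤ => (v.1, v.2 + 1)) = id := by
    funext v
    simp
  rw [this, MvPolynomial.rename_id_apply]

/-- G begins with -1, so g_j sits at order `j + 1`. Setting `a = b = 0` turns G into -1, which
explains the sign of the summation constants -c_{j+1}. -/
theorem exists_hat : ∃ F G : (DiffcePoly (Fin 2))⟦X⟧, constantCoeff G = -1 ∧
    IsTodaSolution (shift 1) (shift (-1)) a b F G 1 ∧
    ∀ c j, (fg c j).1 = coeff j (map (algebraMap ℂ (DiffcePoly (Fin 2))) (constSeries c) * F) ∧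
      (fg c j).2
        = coeff (j + 1) (map (algebraMap ℂ (DiffcePoly (Fin 2))) (constSeries c) * G) := by
  obtain ⟨F, G, h0, h1⟩ :=
    exists_isTodaSolution_one (shift 1 : DiffcePoly (Fin 2) →ₐ[ℂ] _) (shift (-1)) a b
  refine ⟨F, G, h0, h1, fun c => ?_⟩
  have hε : map (MvPolynomial.constantCoeff : DiffcePoly (Fin 2) →+* ℂ) G = -1 := by
    rw [← neg_eq_iff_eq_neg]
    refine eq_one_of_sq_eq_one (by simp [constantCoeff_map_apply, h0]) ?_
    have e2 := congrArg (map (MvPolynomial.constantCoeff : DiffcePoly (Fin 2) →+* ℂ)) h1.eq_g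
    simpa [a] using e2
  set s := map (algebraMap ℂ (DiffcePoly (Fin 2))) (constSeries c) with hs
  have hsol := h1.mul (constSeries c)
  rw [← hs] at hsol
  have hsG : constantCoeff (s * G) = -1 := by
    rw [map_mul, h0, hs, constantCoeff_map_eq_one _ (constantCoeff_constSeries c), one_mul]
  have hdiff := hsol.difference_eq_zero shift_neg_shift hsG (by
    rw [mul_one, hs, ← map_pow]
    ext1 n
    rw [coeff_map, coeff_map]
    exact (shift (-1)).commutes _)
  have hε' : ∀ l, MvPolynomial.constantCoeff (coeff (l + 1) (s * G)) = -c (l + 1) := fun l => by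
    have : map (MvPolynomial.constantCoeff : DiffcePoly (Fin 2) →+* ℂ) (s * G)
        = -constSeries c := by
      rw [map_mul, hε, mul_neg_one, hs]
      ext n
      simp
    have := congrArg (coeff (l + 1)) this
    rwa [coeff_map, map_neg, coeff_succ_constSeries] at this
  have hG0 : coeff 0 (s * G) = -1 := (coeff_zero_eq_constantCoeff_apply _).trans hsG
  have hhalf : 2 * (MvPolynomial.C (1 / 2) : DiffcePoly (Fin 2)) = 1 := two_mul_half _
  intro j
  induction j with
  | zero =>
    refine ⟨(hsol.coeff_f_zero hsG).symm, ?_⟩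
    have h2 := coeff_toda_one.symm.trans (congrArg (coeff 1) hdiff)
    rw [hG0, map_neg, map_one, sub_self, mul_zero, add_zero, map_zero] at h2
    -- At order 1 the difference equation only says that the coefficient is shift-invariant, hence
    -- equal to its constant term -c_1.
    rw [eq_C_of_shift_eq (sub_eq_zero.1 h2).symm, hε' 0]
    rfl
  | succ j ih =>
    refine ⟨?_, ?_⟩
    · have h2 := hsol.coeff_f_succ j
      rw [fg, ih.1, ih.2]
      simp only
      linear_combination (coeff (j + 1) (s * F) + b * coeff j (s * F)) * hhalf
        - MvPolynomial.C (1 / 2) * h2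
    · have h2 := (coeff_toda_add_two j).symm.trans (congrArg (coeff (j + 2)) hdiff)
      rw [map_zero] at h2
      rw [fg, ih.1, ih.2]
      simp only
      rw [integral_bdiff_eq (Q := coeff (j + 2) (s * G)) (by linear_combination h2), hε' (j + 1),
        map_neg]
      ring

/-- The shift of sequences. -/
def funShift (s : ℤ) : (ℤ → ℂ) →ₐ[ℂ] (ℤ → ℂ) where
  toFun f := fun n => f (n + s)
  map_one' := rfl
  map_mul' _ _ := rfl
  map_zero' := rfl
  map_add' _ _ := rfl
  commutes' _ := rfl

theorem funShift_apply (s : ℤ) (f : ℤ → ℂ) (n : ℤ) : funShift s f n = f (n + s) := rfl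

/-- Evaluation of difference polynomials at sequences. -/
def evalDiffce (u : Fin 2 → ℤ → ℂ) : DiffcePoly (Fin 2) →ₐ[ℂ] (ℤ → ℂ) :=
  MvPolynomial.aeval fun v n => u v.1 (n + v.2)

theorem evalDiffce_shift (u : Fin 2 → ℤ → ℂ) (s : ℤ) (Q : DiffcePoly (Fin 2)) :
    evalDiffce u (shift s Q) = funShift s (evalDiffce u Q) := by
  have : (evalDiffce u).comp (shift s) = (funShift s).comp (evalDiffce u) := by
    refine MvPolynomial.algHom_ext fun v => ?_
    funext n
    simp [evalDiffce, shift, funShift_apply, add_assoc, add_comm s]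
  exact DFunLike.congr_fun this Q

theorem evalDiffce_eq (u : Fin 2 → ℤ → ℂ) (Q : DiffcePoly (Fin 2)) :
    evalDiffce u Q = DiffcePoly.at u Q := by
  funext n
  rw [DiffcePoly.at]
  induction Q using MvPolynomial.induction_on with
  | C r => rw [MvPolynomial.eval_C, ← MvPolynomial.algebraMap_eq, AlgHom.commutes]; rfl
  | add p q hp hq => rw [map_add, map_add, ← hp, ← hq]; rfl
  | mul_X p v hp =>
    rw [map_mul, map_mul, ← hp, MvPolynomial.eval_X, evalDiffce, MvPolynomial.aeval_X]
    rfl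

/-- `∑ f_j ζ^j`. -/
def fSeries (a b : ℤ → ℂ) (c : ℕ → ℂ) : (ℤ → ℂ)⟦X⟧ := mk fun j => fAt a b c j

/-- `-1 + ∑ g_j ζ^(j+1)`. -/
def gSeries (a b : ℤ → ℂ) (c : ℕ → ℂ) : (ℤ → ℂ)⟦X⟧ :=
  mk fun l => if l = 0 then -1 else gAt a b c (l - 1)

theorem coeff_fSeries (a b : ℤ → ℂ) (c : ℕ → ℂ) (j : ℕ) :
    coeff j (fSeries a b c) = fAt a b c j := coeff_mk _ _

theorem coeff_zero_gSeries (a b : ℤ → ℂ) (c : ℕ → ℂ) : coeff 0 (gSeries a b c) = -1 := by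
  rw [gSeries, coeff_mk, if_pos rfl]

theorem constantCoeff_gSeries (a b : ℤ → ℂ) (c : ℕ → ℂ) : constantCoeff (gSeries a b c) = -1 :=
  (coeff_zero_eq_constantCoeff_apply _).symm.trans (coeff_zero_gSeries a b c)

theorem coeff_succ_gSeries (a b : ℤ → ℂ) (c : ℕ → ℂ) (j : ℕ) :
    coeff (j + 1) (gSeries a b c) = gAt a b c j := by
  rw [gSeries, coeff_mk, if_neg j.succ_ne_zero, Nat.add_sub_cancel]

theorem series_spec (a b : ℤ → ℂ) (c : ℕ → ℂ) :
    IsTodaSolution (funShift 1) (funShift (-1)) a b (fSeries a b c) (gSeries a b c)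
      (map (algebraMap ℂ (ℤ → ℂ)) (constSeries c ^ 2)) := by
  obtain ⟨F, G, h0, h1, h2⟩ := exists_hat
  have hsol := (h1.mul (constSeries c)).map (P' := funShift 1) (M' := funShift (-1))
    (evalDiffce ![a, b]) (evalDiffce_shift _ _) (evalDiffce_shift _ _)
  have eF : fSeries a b c = map (evalDiffce ![a, b] : DiffcePoly (Fin 2) →ₐ[ℂ] _).toRingHom
      (map (algebraMap ℂ (DiffcePoly (Fin 2))) (constSeries c) * F) := by
    ext1 l
    rw [coeff_fSeries, fAt, (h2 c l).1, coeff_map, ← evalDiffce_eq]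
    rfl
  have eG : gSeries a b c = map (evalDiffce ![a, b] : DiffcePoly (Fin 2) →ₐ[ℂ] _).toRingHom
      (map (algebraMap ℂ (DiffcePoly (Fin 2))) (constSeries c) * G) := by
    ext1 l
    cases l with
    | zero =>
      rw [coeff_zero_gSeries, coeff_map, coeff_zero_eq_constantCoeff_apply, map_mul, h0,
        constantCoeff_map_eq_one _ (constantCoeff_constSeries c), one_mul, map_neg, map_one]
    | succ l =>
      rw [coeff_succ_gSeries, gAt, (h2 c l).2, coeff_map, ← evalDiffce_eq]
      rfl
  have er : map (algebraMap ℂ (ℤ → ℂ)) (constSeries c ^ 2)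
      = map (evalDiffce ![a, b] : DiffcePoly (Fin 2) →ₐ[ℂ] _).toRingHom
        (map (algebraMap ℂ (DiffcePoly (Fin 2))) (constSeries c) ^ 2 * 1) := by
    rw [mul_one, ← map_pow]
    ext1 l
    rw [coeff_map, coeff_map, coeff_map]
    exact ((evalDiffce ![a, b]).commutes _).symm
  have ea : (evalDiffce ![a, b]) Toda.a = a := by
    rw [Toda.a, evalDiffce, MvPolynomial.aeval_X]
    funext n
    simp
  have eb : (evalDiffce ![a, b]) Toda.b = b := by
    rw [Toda.b, evalDiffce, MvPolynomial.aeval_X]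
    funext n
    simp
  rw [ea, eb] at hsol
  rw [eF, eG, er]
  exact hsol

/-- `ζ^(g+1) G_{g+1}`. -/
def gCut (a b : ℤ → ℂ) (c : ℕ → ℂ) (g : ℕ) : (ℤ → ℂ)⟦X⟧ :=
  cut (g + 1) (gSeries a b c) + C (fAt a b c (g + 1)) * X ^ (g + 1)

theorem coeff_gCut (a b : ℤ → ℂ) (c : ℕ → ℂ) (g l : ℕ) : coeff l (gCut a b c g)
    = (if l ≤ g + 1 then coeff l (gSeries a b c) else 0)
      + if l = g + 1 then fAt a b c (g + 1) else 0 := by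
  rw [gCut, map_add, coeff_cut, coeff_C_mul, coeff_X_pow]
  congr 1
  split_ifs <;> simp

theorem constantCoeff_gCut (a b : ℤ → ℂ) (c : ℕ → ℂ) (g : ℕ) :
    constantCoeff (gCut a b c g) = -1 := by
  rw [← coeff_zero_eq_constantCoeff_apply, coeff_gCut, if_pos (by omega), if_neg (by omega),
    coeff_zero_gSeries, add_zero]

theorem fAt_succ (a b : ℤ → ℂ) (c : ℕ → ℂ) (l : ℕ) (n : ℤ) :
    2 * fAt a b c (l + 1) n + 2 * (b n * fAt a b c l n) + gAt a b c l n
      + gAt a b c l (n - 1) = 0 := by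
  have := congrFun ((series_spec a b c).coeff_f_succ l) n
  rw [coeff_fSeries, coeff_fSeries, coeff_succ_gSeries] at this
  simpa [funShift_apply, sub_eq_add_neg] using this

/-- Subtracting the recursion for f_{g+1} at `n` from the first stationary equation at `n - 1`
leaves f_{g+1}(n - 1) = f_{g+1}(n). -/
theorem fAt_stationary {a b : ℤ → ℂ} {c : ℕ → ℂ} {g : ℕ} (h : IsStationary a b c g) :
    funShift (-1) (fAt a b c (g + 1)) = fAt a b c (g + 1) := by
  funext n
  have h1 := (h (n - 1)).1
  have h2 := fAt_succ a b c g n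
  rw [sub_add_cancel] at h1
  rw [funShift_apply, ← sub_eq_add_neg]
  linear_combination h1 - h2

/-- At order `g + 1` cutting F removes 2f_{g+1}. The extra term f_{g+1} in G is constant in `n`, so
it contributes twice to G + G⁻ and makes up for the loss. -/
theorem gCut_isTodaSolution {a b : ℤ → ℂ} {c : ℕ → ℂ} {g : ℕ} (h : IsStationary a b c g) :
    IsTodaSolution (funShift 1) (funShift (-1)) a b (cut g (fSeries a b c)) (gCut a b c g)
      (gCut a b c g ^ 2 - 4 * X ^ 2 * C a ^ 2 * (cut g (fSeries a b c) *
        map (funShift 1 : (ℤ → ℂ) →+* (ℤ → ℂ)) (cut g (fSeries a b c)))) := by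
  have hsol := series_spec a b c
  refine ⟨?_, rfl⟩
  ext1 l
  rw [map_zero]
  cases l with
  | zero =>
    have := hsol.coeff_f_zero (constantCoeff_gSeries a b c)
    rw [coeff_toda_eq_f_zero, coeff_cut, if_pos (Nat.zero_le g), this,
      coeff_zero_eq_constantCoeff_apply, constantCoeff_gCut, map_neg, map_one]
    norm_num
  | succ l =>
    have h1 := hsol.coeff_f_succ l
    rw [coeff_toda_eq_f_succ, coeff_gCut, coeff_cut, coeff_cut]
    rcases lt_trichotomy l g with hl | rfl | hl
    · rwa [if_pos (by omega), if_pos (by omega), if_pos (by omega), if_neg (by omega), add_zero]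
    · rw [if_neg (by omega), if_pos (by omega), if_pos (by omega), if_pos rfl, map_add,
        fAt_stationary h]
      rw [coeff_fSeries _ _ _ (l + 1)] at h1
      linear_combination h1
    · rw [if_neg (by omega), if_neg (by omega), if_neg (by omega), if_neg (by omega), add_zero,
        map_zero]
      ring

theorem gCut_sub_shift {a b : ℤ → ℂ} {c : ℕ → ℂ} {g : ℕ} (h : IsStationary a b c g) (l : ℕ) :
    coeff l (gCut a b c g) - funShift (-1) (coeff l (gCut a b c g)) = if l ≤ g + 1 then
      coeff l (gSeries a b c) - funShift (-1) (coeff l (gSeries a b c)) else 0 := by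
  rw [coeff_gCut, map_add]
  have h1 : (if l = g + 1 then fAt a b c (g + 1) else 0)
      - funShift (-1) (if l = g + 1 then fAt a b c (g + 1) else 0) = 0 := by
    split_ifs
    · rw [fAt_stationary h, sub_self]
    · rw [map_zero, sub_self]
  have h2 : (if l ≤ g + 1 then coeff l (gSeries a b c) else 0)
      - funShift (-1) (if l ≤ g + 1 then coeff l (gSeries a b c) else 0) = if l ≤ g + 1 then
      coeff l (gSeries a b c) - funShift (-1) (coeff l (gSeries a b c)) else 0 := by
    split_ifs
    · rfl
    · rw [map_zero, sub_self]
  linear_combination h1 + h2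

/-- The added constant drops out of differences, so the cut matters only at order `g + 2`, where the
stationary equations take over. -/
theorem gCut_difference {a b : ℤ → ℂ} {c : ℕ → ℂ} {g : ℕ} (h : IsStationary a b c g) :
    (1 + X * C b) * (gCut a b c g - map (funShift (-1) : (ℤ → ℂ) →+* (ℤ → ℂ)) (gCut a b c g))
      + 2 * X ^ 2 * (C a ^ 2 * map (funShift 1 : (ℤ → ℂ) →+* (ℤ → ℂ)) (cut g (fSeries a b c))
        - C (funShift (-1) a) ^ 2 *
          map (funShift (-1) : (ℤ → ℂ) →+* (ℤ → ℂ)) (cut g (fSeries a b c))) = 0 := by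
  have hdiff := (series_spec a b c).difference_eq_zero
    (fun f => funext fun n => congrArg f (by ring)) (constantCoeff_gSeries a b c) (by
      ext1 n
      rw [coeff_map, coeff_map]
      exact (funShift (-1)).commutes _)
  have d0 : coeff 0 (gSeries a b c) - funShift (-1) (coeff 0 (gSeries a b c)) = 0 := by
    rw [coeff_zero_gSeries, map_neg, map_one, sub_self]
  ext1 l
  rw [map_zero]
  match l with
  | 0 => rw [coeff_toda_zero, gCut_sub_shift h, if_pos (by omega), d0]
  | 1 =>
    have h1 := coeff_toda_one.symm.trans (congrArg (coeff 1) hdiff)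
    rw [map_zero] at h1
    rw [coeff_toda_one, gCut_sub_shift h, gCut_sub_shift h, if_pos (by omega), if_pos (by omega),
      h1]
  | l + 2 =>
    have h1 := (coeff_toda_add_two l).symm.trans (congrArg (coeff (l + 2)) hdiff)
    rw [map_zero] at h1
    rw [coeff_toda_add_two, gCut_sub_shift h, gCut_sub_shift h, coeff_cut]
    rcases lt_trichotomy l g with hl | rfl | hl
    · rwa [if_pos (by omega), if_pos (by omega), if_pos (by omega)]
    · rw [if_neg (by omega), if_pos (by omega), if_pos (by omega), coeff_succ_gSeries,
        coeff_fSeries]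
      funext n
      have e1 := (h (n - 1)).1
      have e2 := (h n).2
      have e3 := congrFun (fAt_stationary h) n
      rw [sub_add_cancel] at e1
      rw [funShift_apply, ← sub_eq_add_neg] at e3
      simp only [Pi.add_apply, Pi.mul_apply, Pi.sub_apply, Pi.pow_apply, funShift_apply,
        Pi.ofNat_apply, ← sub_eq_add_neg]
      -- Twice the second stationary equation has b · 2(g_g + f_{g+1}) where b(g_g - g_g⁻) is
      -- wanted. The first one at `n - 1` corrects this up to b(f_{g+1} - f_{g+1}⁻), which is zero.
      linear_combination 2 * e2 - b n * e1 + b n * e3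
    · rw [if_neg (by omega), if_neg (by omega), if_neg (by omega), map_zero, map_zero]
      ring

theorem map_evalAt_cut_fSeries (a b : ℤ → ℂ) (c : ℕ → ℂ) (g : ℕ) (n : ℤ) :
    map (Pi.evalRingHom (fun _ : ℤ => ℂ) n) (cut g (fSeries a b c))
      = revSeries g (F a b c g n) := by
  ext j
  rw [coeff_map, F, coeff_revSeries_zPoly, coeff_cut, coeff_fSeries]
  split_ifs <;> rfl

theorem natDegree_G_le (a b : ℤ → ℂ) (c : ℕ → ℂ) (g : ℕ) (n : ℤ) :
    (G a b c g n).natDegree ≤ g + 1 := by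
  refine Polynomial.natDegree_add_le_of_degree_le (Polynomial.natDegree_add_le_of_degree_le ?_ ?_) ?_
  · rw [Polynomial.natDegree_neg]
    exact Polynomial.natDegree_X_pow_le _
  · exact (natDegree_zPoly_le _ _).trans g.le_succ
  · simp

theorem map_evalAt_gCut (a b : ℤ → ℂ) (c : ℕ → ℂ) (g : ℕ) (n : ℤ) :
    map (Pi.evalRingHom (fun _ : ℤ => ℂ) n) (gCut a b c g) = revSeries (g + 1) (G a b c g n) := by
  have e1 : revSeries (g + 1) (-Polynomial.X ^ (g + 1)) = -1 := by
    rw [revSeries, Polynomial.reflect_neg, Polynomial.reflect_monomial]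
    simp
  have e2 : revSeries (g + 1) (Polynomial.C (fAt a b c (g + 1) n))
      = C (fAt a b c (g + 1) n) * X ^ (g + 1) := by
    rw [revSeries, Polynomial.reflect_C]
    simp
  have e3 : revSeries (g + 1) (zPoly (g + 1) fun j => gAt a b c j n)
      = X ^ 1 * revSeries g (zPoly (g + 1) fun j => gAt a b c j n) := by
    rw [← revSeries_of_natDegree_le (natDegree_zPoly_le _ _), add_comm 1 g]
  rw [G, revSeries_add, revSeries_add, e1, e2, e3, gCut, map_add, map_mul, map_pow, map_X, map_C]
  congr 1
  ext l
  rw [coeff_map, coeff_cut]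
  cases l with
  | zero =>
    rw [if_pos (by omega), coeff_zero_gSeries]
    simp
  | succ l =>
    rw [pow_one, map_add, coeff_succ_X_mul, coeff_revSeries_zPoly, coeff_succ_gSeries]
    by_cases hl : l ≤ g
    · rw [if_pos (by omega), if_pos hl]
      simp
    · rw [if_neg (by omega), if_neg hl]
      simp

theorem revSeries_R (a b : ℤ → ℂ) (c : ℕ → ℂ) (g : ℕ) (n : ℤ) :
    revSeries (2 * g + 2) (R a b c g n) = map (Pi.evalRingHom (fun _ : ℤ => ℂ) n)
      (gCut a b c g ^ 2 - 4 * X ^ 2 * C a ^ 2 * (cut g (fSeries a b c) *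
        map (funShift 1 : (ℤ → ℂ) →+* (ℤ → ℂ)) (cut g (fSeries a b c)))) := by
  have dF : ∀ n, (F a b c g n).natDegree ≤ g := fun n => natDegree_zPoly_le _ _
  have dG := natDegree_G_le a b c g n
  have hs : map (Pi.evalRingHom (fun _ : ℤ => ℂ) n)
      (map (funShift 1 : (ℤ → ℂ) →+* (ℤ → ℂ)) (cut g (fSeries a b c)))
      = map (Pi.evalRingHom (fun _ : ℤ => ℂ) (n + 1)) (cut g (fSeries a b c)) := by
    ext l
    rw [coeff_map, coeff_map, coeff_map]
    rfl
  have h4 : map (Pi.evalRingHom (fun _ : ℤ => ℂ) n) (4 : (ℤ → ℂ)⟦X⟧) = 4 := map_ofNat _ 4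
  have hR : R a b c g n = G a b c g n * G a b c g n
      - Polynomial.C (4 * a n ^ 2) * (F a b c g n * F a b c g (n + 1)) := by
    rw [R]; ring
  have h5 : (C (4 * a n ^ 2) : ℂ⟦X⟧) = 4 * C (a n) ^ 2 := by
    rw [map_mul, map_pow, map_ofNat]
  rw [hR, revSeries_sub, revSeries_C_mul, show 2 * g + 2 = (g + 1) + (g + 1) by ring,
    revSeries_mul dG dG, show (g + 1) + (g + 1) = 2 + (g + g) by ring,
    revSeries_of_natDegree_le (Polynomial.natDegree_mul_le_of_le (dF n) (dF (n + 1))),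
    revSeries_mul (dF n) (dF (n + 1)), h5]
  simp only [map_sub, map_mul, map_pow, map_X, map_C, hs, h4, map_evalAt_cut_fSeries,
    map_evalAt_gCut, Pi.evalRingHom_apply]
  ring

/-- Shift-invariant sequences are constant, so a single site `n₀` determines the first integral. -/
theorem eq_map_of_shift_eq {r : (ℤ → ℂ)⟦X⟧}
    (h : map (funShift (-1) : (ℤ → ℂ) →+* (ℤ → ℂ)) r = r) (n₀ : ℤ) :
    r = map (algebraMap ℂ (ℤ → ℂ)) (map (Pi.evalRingHom (fun _ : ℤ => ℂ) n₀) r) := by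
  ext1 l
  rw [coeff_map, coeff_map]
  have h1 : ∀ n, coeff l r (n - 1) = coeff l r n := fun n => by
    have := congrFun (congrArg (coeff l) h) n
    rwa [coeff_map] at this
  funext n
  change coeff l r n = coeff l r n₀
  have h2 : ∀ k : ℤ, coeff l r (n₀ + k) = coeff l r n₀ := fun k => by
    induction k using Int.induction_on with
    | zero => rw [add_zero]
    | succ k ih => rw [← ih, ← h1, add_sub_assoc, add_sub_cancel_right]
    | pred k ih => rw [← ih, ← h1 (n₀ + -k), add_sub_assoc]
  simpa using h2 (n - n₀)

theorem hat_formula {g : ℕ} {c : ℕ → ℂ} {a b : ℤ → ℂ} {E : Fin (2 * g + 2) → ℂ} {n₀ : ℤ}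
    (hst : IsStationary a b c g) (hR : R a b c g n₀ = rootPoly E) (n : ℤ) (μ : Fin g → ℂ)
    (hF : F a b c g n = rootPoly μ) (j : ℕ) :
    fHat a b j n = ∑ k ∈ Finset.range (min j g + 1), cCoeff (j - k) E * Psi k μ := by
  have hsol := gCut_isTodaSolution hst
  have hhat := series_spec a b 0
  rw [constSeries_zero, one_pow, map_one] at hhat
  have hshift := hsol.sub_shift fun f => funext fun n => congrArg f (by ring)
  rw [gCut_difference hst, mul_zero, sub_eq_zero] at hshift
  have hr := eq_map_of_shift_eq hshift.symm n₀
  rw [← revSeries_R, hR, revSeries_rootPoly] at hr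
  rw [hr] at hsol
  have hs := hsol.mul (cSeries E)
  rw [← map_pow, ← map_mul, cSeries_sq_mul, map_one] at hs
  have hF' := hhat.unique (constantCoeff_gSeries a b 0) (by
    rw [map_mul, constantCoeff_gCut, constantCoeff_map_eq_one _ (constantCoeff_cSeries E),
      one_mul]) hs
  have h1 := congrArg (coeff j) (congrArg (map (Pi.evalRingHom (fun _ : ℤ => ℂ) n)) hF')
  have h2 : map (Pi.evalRingHom (fun _ : ℤ => ℂ) n) (map (algebraMap ℂ (ℤ → ℂ)) (cSeries E))
      = cSeries E := by
    ext l
    rfl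
  rw [map_mul, h2, map_evalAt_cut_fSeries, hF, revSeries_rootPoly, coeff_cSeries_mul_rootSeries',
    coeff_map, coeff_fSeries] at h1
  exact h1

end Toda

/-! ### The sGmKdV system -/

section SgSystem

variable {A : Type*} [CommRing A] [Algebra ℂ A]

/-- `-¼ (v² + 2 i v')`. -/
def miura (D : Derivation ℂ A A) (v : A) : A := -half A ^ 2 * (v ^ 2 + 2 * imag A * D v)

/-- The linear relations between the generating functions `F`, `G`, `H` of the sGmKdV
coefficients, where `v = u_x`. -/
structure IsSgSolution (D : Derivation ℂ A A) (v : A) (F G H : A⟦X⟧) : Prop where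
  eq_f : coeffDeriv D F = -imag _ * C v * F - 2 * imag _ * G
  eq_g : H = F - imag _ * (X * coeffDeriv D G)
  eq_h : coeffDeriv D H = imag _ * C v * H + 2 * imag _ * G

theorem IsSgSolution.mul {D : Derivation ℂ A A} {v : A} {F G H s : A⟦X⟧}
    (h : IsSgSolution D v F G H) (hs : coeffDeriv D s = 0) :
    IsSgSolution D v (s * F) (s * G) (s * H) := by
  constructor <;> simp only [Derivation.leibniz, smul_eq_mul, hs, mul_zero, add_zero]
  · linear_combination s * h.eq_f
  · linear_combination s * h.eq_g
  · linear_combination s * h.eq_h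

/-- Miura transformation: eliminating F' and F'' by the first-order relation cancels the terms in v
and v' against the potential. -/
theorem kdvForm_miura {D : Derivation ℂ A A} {v : A} {F G : A⟦X⟧}
    (hF : coeffDeriv D F = -imag _ * C v * F - 2 * imag _ * G) :
    kdvForm D (miura D v) F = X * G ^ 2 + F * (F - imag _ * (X * coeffDeriv D G)) := by
  have hF2 : coeffDeriv D (coeffDeriv D F) = -imag _ * (C (D v) * F + C v * coeffDeriv D F)
      - 2 * imag _ * coeffDeriv D G := by
    rw [hF]
    have h2 : coeffDeriv D (2 : A⟦X⟧) = 0 := by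
      rw [← map_ofNat (C : A →+* A⟦X⟧) 2, coeffDeriv_C, ← map_ofNat (algebraMap ℂ A) 2,
        Derivation.map_algebraMap, map_zero]
    simp only [map_sub, map_neg, Derivation.leibniz, smul_eq_mul, coeffDeriv_imag, coeffDeriv_C, h2]
    linear_combination (-imag _ * C v) * hF
  have hw : C (miura D v) = -half A⟦X⟧ ^ 2 * (C v ^ 2 + 2 * imag _ * C (D v)) := by
    rw [miura, half_eq_C, imag_eq_C, ← map_ofNat (C : A →+* A⟦X⟧) 2]
    simp only [map_mul, map_neg, map_add, map_pow]
  have h2 := two_mul_half A⟦X⟧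
  have hi := imag_sq A⟦X⟧
  rw [kdvForm, hF2, hw, hF]
  -- What remains is a polynomial identity modulo 2k = 1 and i² = -1.
  generalize coeffDeriv D G = G' at *
  generalize C (D v) = v' at *
  generalize C v = w at *
  generalize half A⟦X⟧ = k at *
  generalize imag A⟦X⟧ = i at *
  linear_combination X * (i * v' * k * F ^ 2 - i * G' * F + w ^ 2 * F ^ 2 * k + 2 * k * w * F * G
    + G ^ 2 * (2 * k + 1)) * h2
    + X * (k * w * F * (w * F + 2 * G) - k ^ 2 * (w * F + 2 * G) ^ 2) * hi

theorem isSgSolution_iff_coeff {D : Derivation ℂ A A} {v : A} {F G H : A⟦X⟧} :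
    IsSgSolution D v F G H ↔
      (∀ j, D (coeff j F) = -imag A * v * coeff j F - 2 * imag A * coeff j G) ∧
      (coeff 0 H = coeff 0 F ∧ ∀ j, coeff (j + 1) H = coeff (j + 1) F - imag A * D (coeff j G)) ∧
      ∀ j, D (coeff j H) = imag A * v * coeff j H + 2 * imag A * coeff j G := by
  have h2 : (2 : A⟦X⟧) = C 2 := (map_ofNat _ 2).symm
  have e1 : coeffDeriv D F = -imag _ * C v * F - 2 * imag _ * G ↔
      ∀ j, D (coeff j F) = -imag A * v * coeff j F - 2 * imag A * coeff j G := by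
    rw [PowerSeries.ext_iff]
    refine forall_congr' fun j => ?_
    rw [imag_eq_C, h2, ← map_neg, ← map_mul, ← map_mul, map_sub, coeff_C_mul, coeff_C_mul,
      coeff_coeffDeriv]
  have e3 : coeffDeriv D H = imag _ * C v * H + 2 * imag _ * G ↔
      ∀ j, D (coeff j H) = imag A * v * coeff j H + 2 * imag A * coeff j G := by
    rw [PowerSeries.ext_iff]
    refine forall_congr' fun j => ?_
    rw [imag_eq_C, h2, ← map_mul, ← map_mul, map_add, coeff_C_mul, coeff_C_mul, coeff_coeffDeriv]
  have e2 : H = F - imag _ * (X * coeffDeriv D G) ↔ coeff 0 H = coeff 0 F ∧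
      ∀ j, coeff (j + 1) H = coeff (j + 1) F - imag A * D (coeff j G) := by
    rw [PowerSeries.ext_iff, ← Nat.and_forall_add_one]
    simp only [imag_eq_C, map_sub, coeff_C_mul, coeff_succ_X_mul, coeff_zero_X_mul, mul_zero,
      sub_zero, coeff_coeffDeriv]
  exact ⟨fun h => ⟨e1.1 h.eq_f, e2.1 h.eq_g, e3.1 h.eq_h⟩,
    fun h => ⟨e1.2 h.1, e2.2 h.2.1, e3.2 h.2.2⟩⟩

theorem IsSgSolution.kdvForm_f {D : Derivation ℂ A A} {v : A} {F G H : A⟦X⟧}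
    (h : IsSgSolution D v F G H) : kdvForm D (miura D v) F = X * G ^ 2 + F * H := by
  rw [kdvForm_miura h.eq_f, h.eq_g]

/-- The relations are symmetric under exchanging F with H and changing the signs of v and G. -/
theorem IsSgSolution.kdvForm_h {D : Derivation ℂ A A} {v : A} {F G H : A⟦X⟧}
    (h : IsSgSolution D v F G H) : kdvForm D (miura D (-v)) H = X * G ^ 2 + F * H := by
  rw [kdvForm_miura (G := -G) (by rw [h.eq_h, map_neg]; ring), map_neg]
  linear_combination H * h.eq_g

theorem IsSgSolution.coeffDeriv_form {D : Derivation ℂ A A} {v : A} {F G H : A⟦X⟧}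
    (h : IsSgSolution D v F G H) : coeffDeriv D (X * G ^ 2 + F * H) = 0 := by
  simp only [map_add, Derivation.leibniz, Derivation.leibniz_pow, smul_eq_mul, coeffDeriv_X,
    nsmul_eq_mul]
  push_cast
  linear_combination F * h.eq_h + H * h.eq_f - 2 * imag _ * G * h.eq_g
    + 2 * G * X * coeffDeriv D G * imag_sq A⟦X⟧

/-- The first two relations define G and H. The derivative of the form is then F times the defect of
the third, and F is a unit. -/
theorem isSgSolution_of_kdvForm {D : Derivation ℂ A A} {v : A} {F : A⟦X⟧}
    (h0 : constantCoeff F = 1) (h : coeffDeriv D (kdvForm D (miura D v) F) = 0) :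
    ∃ G H : A⟦X⟧, constantCoeff H = 1 ∧ IsSgSolution D v F G H := by
  let G : A⟦X⟧ := half _ * imag _ * (coeffDeriv D F + imag _ * C v * F)
  have h2 := two_mul_half A⟦X⟧
  have hi := imag_sq A⟦X⟧
  have eF : coeffDeriv D F = -imag _ * C v * F - 2 * imag _ * G := by
    simp only [G]
    linear_combination (coeffDeriv D F + imag _ * C v * F) * (imag _ ^ 2 * h2 + hi)
  have eQ := kdvForm_miura eF
  rw [eQ] at h
  refine ⟨G, F - imag _ * (X * coeffDeriv D G), by simp [h0], eF, rfl, ?_⟩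
  generalize hH : F - imag _ * (X * coeffDeriv D G) = H at *
  simp only [map_add, Derivation.leibniz, Derivation.leibniz_pow, smul_eq_mul, coeffDeriv_X,
    nsmul_eq_mul] at h
  push_cast at h
  have h3 : F * (coeffDeriv D H - (imag _ * C v * H + 2 * imag _ * G)) = 0 := by
    linear_combination h - H * eF - 2 * imag _ * G * hH - 2 * G * X * coeffDeriv D G * hi
  exact sub_eq_zero.1 (((isUnit_of_constantCoeff_eq_one h0).mul_right_eq_zero).1 h3)

end SgSystem

/-! ### sGmKdV: the pair of KdV series, the modified top coefficient, and the formulas -/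

namespace SGmKdV

open Complex (I)

/-- The potential `w_+` of a smooth function. -/
def potPlus (u : Smooth) : Smooth := miura Smooth.der (Smooth.der u)

/-- The potential `w_-` of a smooth function. -/
def potMinus (u : Smooth) : Smooth := miura Smooth.der (-Smooth.der u)

theorem coe_potPlus (u : Smooth) : (potPlus u).1 = wPlus u.1 := by
  funext x
  change -(1 / 2 : ℂ) ^ 2 * (deriv u.1 x ^ 2 + 2 * I * deriv (deriv u.1) x) = _
  rw [wPlus]
  ring

theorem coe_potMinus (u : Smooth) : (potMinus u).1 = wMinus u.1 := by
  have : potMinus u = -half Smooth ^ 2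
      * (Smooth.der u ^ 2 - 2 * imag Smooth * Smooth.der (Smooth.der u)) := by
    rw [potMinus, miura, map_neg]
    ring
  rw [this]
  funext x
  change -(1 / 2 : ℂ) ^ 2 * (deriv u.1 x ^ 2 - 2 * I * deriv (deriv u.1) x) = _
  rw [wMinus]
  ring

/-- The partner H of the homogeneous series for w_+ has form 1 for w_-, so by uniqueness it is the
homogeneous series for w_-. Common integration constants multiply the whole triple by one constant
series. -/
theorem exists_isSgSolution (u : Smooth) (c : ℕ → ℂ) : ∃ G : Smooth⟦X⟧,
    IsSgSolution Smooth.der (Smooth.der u) (KdV.fSeries (potPlus u) c) G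
      (KdV.fSeries (potMinus u) c) := by
  obtain ⟨h0, h1⟩ := KdV.fSeries_zero_spec (potPlus u)
  obtain ⟨G, H, hH, hsol⟩ := isSgSolution_of_kdvForm (v := Smooth.der u) h0
    (by rw [← potPlus, h1]; exact Derivation.map_one_eq_zero _)
  have h2 := hsol.kdvForm_h
  rw [← hsol.kdvForm_f, ← potPlus, h1, ← potMinus] at h2
  obtain ⟨h3, h4⟩ := KdV.fSeries_zero_spec (potMinus u)
  have := kdvForm_eq_one_unique _ _ hH h2 h3 h4
  rw [this] at hsol
  rw [KdV.fSeries_eq _ c, KdV.fSeries_eq (potMinus u) c]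
  exact ⟨_, hsol.mul (coeffDeriv_map_algebraMap _ _)⟩

/-- `k e^{s u}`. -/
def expSmooth (u : Smooth) (k s : ℂ) : Smooth :=
  ⟨fun x => k * Complex.exp (s * u.1 x), by
    have hu : ContDiff ℝ ∞ u.1 := u.2
    exact contDiff_const.mul (contDiff_const.mul hu).cexp⟩

theorem der_expSmooth (u : Smooth) (k s : ℂ) :
    Smooth.der (expSmooth u k s) = algebraMap ℂ Smooth s * Smooth.der u * expSmooth u k s := by
  refine Smooth.ext_evalAt fun x => ?_
  change deriv (fun x => k * Complex.exp (s * u.1 x)) x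
    = s * deriv u.1 x * (k * Complex.exp (s * u.1 x))
  have h := (((differentiableAt_smooth u.2 x).hasDerivAt.const_mul s).cexp.const_mul k).deriv
  rw [h]
  ring

/-- `∑_{j < g} a_j ζ^j + e ζ^g`. -/
def patch {A : Type*} [CommRing A] (g : ℕ) (a : A⟦X⟧) (e : A) : A⟦X⟧ :=
  mk fun j => if j < g then coeff j a else if j = g then e else 0

theorem coeff_patch {A : Type*} [CommRing A] (g : ℕ) (a : A⟦X⟧) (e : A) (j : ℕ) :
    coeff j (patch g a e) = if j < g then coeff j a else if j = g then e else 0 := coeff_mk _ _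

/-- The exponentials solve the first and third relations at order `g` with no G-term. The middle
relation at order `g` is the stationary equation. -/
theorem patch_isSgSolution {u : Smooth} {α β : ℂ} {c : ℕ → ℂ} {g : ℕ} {G : Smooth⟦X⟧}
    (hsol : IsSgSolution Smooth.der (Smooth.der u) (KdV.fSeries (potPlus u) c) G
      (KdV.fSeries (potMinus u) c))
    (hst : (if g = 0 then 0 else imag Smooth * Smooth.der (coeff (g - 1) G))
      + expSmooth u β I - expSmooth u α (-I) = 0) :
    IsSgSolution Smooth.der (Smooth.der u)
      (patch g (KdV.fSeries (potPlus u) c) (expSmooth u α (-I))) (patch g G 0)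
      (patch g (KdV.fSeries (potMinus u) c) (expSmooth u β I)) := by
  obtain ⟨h1, ⟨h2, h3⟩, h4⟩ := isSgSolution_iff_coeff.1 hsol
  refine isSgSolution_iff_coeff.2 ⟨fun j => ?_, ⟨?_, fun j => ?_⟩, fun j => ?_⟩ <;>
    simp only [coeff_patch]
  · rcases lt_trichotomy j g with hj | rfl | hj
    · rw [if_pos hj, if_pos hj, h1]
    · simp only [lt_irrefl, if_false, if_true, der_expSmooth, map_neg, imag, mul_zero, sub_zero]
    · rw [if_neg (by omega), if_neg (by omega), if_neg (by omega), if_neg (by omega), map_zero]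
      ring
  -- For `g = 0` the top coefficient is also the leading one, and stationarity becomes equality of
  -- the two exponentials.
  · rcases Nat.eq_zero_or_pos g with rfl | hg
    · rw [if_pos rfl] at hst
      simp only [lt_irrefl, if_false, if_true]
      linear_combination hst
    · rw [if_pos hg, if_pos hg, h2]
  · rcases lt_trichotomy (j + 1) g with hj | rfl | hj
    · rw [if_pos hj, if_pos hj, if_pos (by omega), h3]
    · rw [if_neg (by omega), Nat.add_sub_cancel] at hst
      rw [if_neg (by omega), if_pos rfl, if_neg (by omega), if_pos rfl, if_pos (by omega)]
      linear_combination hst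
    · rw [if_neg (by omega), if_neg (by omega), if_neg (by omega), if_neg (by omega),
        if_neg (by omega), ite_self, map_zero]
      ring
  · rcases lt_trichotomy j g with hj | rfl | hj
    · rw [if_pos hj, if_pos hj, h4]
    · simp only [lt_irrefl, if_false, if_true, der_expSmooth, imag, mul_zero, add_zero]
    · rw [if_neg (by omega), if_neg (by omega), if_neg (by omega), if_neg (by omega), map_zero]
      ring

theorem coe_coeff_patch_f (u : Smooth) (α : ℂ) (c : ℕ → ℂ) (g : ℕ) {j : ℕ} (hj : j ≤ g) :
    (coeff j (patch g (KdV.fSeries (potPlus u) c) (expSmooth u α (-I)))).1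
      = fAt u.1 α g c j := by
  funext x
  rw [coeff_patch, fAt]
  rcases hj.lt_or_eq with h | rfl
  · rw [if_pos h, if_neg (by omega), KdV.coe_coeff_fSeries, coe_potPlus]
  · rw [if_neg (by omega), if_pos rfl, if_pos rfl]
    rfl

theorem coe_coeff_patch_h (u : Smooth) (β : ℂ) (c : ℕ → ℂ) (g : ℕ) {j : ℕ} (hj : j ≤ g) :
    (coeff j (patch g (KdV.fSeries (potMinus u) c) (expSmooth u β I))).1 = hAt u.1 β g c j := by
  funext x
  rw [coeff_patch, hAt]
  rcases hj.lt_or_eq with h | rfl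
  · rw [if_pos h, if_neg (by omega), KdV.coe_coeff_fSeries, coe_potMinus]
  · rw [if_neg (by omega), if_pos rfl, if_pos rfl]
    rfl

theorem coe_coeff_g {u : Smooth} {α : ℂ} {c : ℕ → ℂ} {g : ℕ} {G : Smooth⟦X⟧}
    (hsol : IsSgSolution Smooth.der (Smooth.der u) (KdV.fSeries (potPlus u) c) G
      (KdV.fSeries (potMinus u) c)) {j : ℕ} (hj : j < g) :
    (coeff j G).1 = gAt u.1 α g c j := by
  have h1 := (isSgSolution_iff_coeff.1 hsol).1 j
  have hf : (coeff j (KdV.fSeries (potPlus u) c)).1 = fAt u.1 α g c j := by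
    rw [← coe_coeff_patch_f u α c g hj.le, coeff_patch, if_pos hj]
  funext x
  have h2 : deriv (coeff j (KdV.fSeries (potPlus u) c)).1 x
      = -I * deriv u.1 x * (coeff j (KdV.fSeries (potPlus u) c)).1 x
        - 2 * I * (coeff j G).1 x := congrFun (congrArg Subtype.val h1) x
  rw [hf] at h2
  rw [gAt, h2]
  linear_combination (coeff j G).1 x * Complex.I_sq

theorem stationary_smooth {u : Smooth} {α β : ℂ} {c : ℕ → ℂ} {g : ℕ} {G : Smooth⟦X⟧}
    (hsol : IsSgSolution Smooth.der (Smooth.der u) (KdV.fSeries (potPlus u) c) G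
      (KdV.fSeries (potMinus u) c)) (hst : IsStationary u.1 α β c g) :
    (if g = 0 then 0 else imag Smooth * Smooth.der (coeff (g - 1) G))
      + expSmooth u β I - expSmooth u α (-I) = 0 := by
  refine Smooth.ext_evalAt fun x => ?_
  have h1 := hst x
  rw [gLast] at h1
  by_cases hg : g = 0
  · rw [if_pos hg] at h1 ⊢
    have h2 : deriv (0 : ℝ → ℂ) x = 0 := deriv_const x 0
    rw [h2] at h1
    change 0 + β * Complex.exp (I * u.1 x) - α * Complex.exp (-I * u.1 x) = 0
    linear_combination h1 / 2
  · rw [if_neg hg, ← coe_coeff_g (α := α) hsol (by omega : g - 1 < g)] at h1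
    rw [if_neg hg]
    change I * deriv (coeff (g - 1) G).1 x + β * Complex.exp (I * u.1 x)
      - α * Complex.exp (-I * u.1 x) = 0
    linear_combination h1 / 2

theorem map_evalAt_patch_f (u : Smooth) (α : ℂ) (c : ℕ → ℂ) (g : ℕ) (x : ℝ) :
    map (Smooth.evalAt x : Smooth →+* ℂ)
        (patch g (KdV.fSeries (potPlus u) c) (expSmooth u α (-I)))
      = revSeries g (F u.1 α c g x) := by
  ext j
  rw [coeff_map, F, coeff_revSeries_zPoly]
  split_ifs with hj
  · exact congrFun (coe_coeff_patch_f u α c g hj) x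
  · rw [coeff_patch, if_neg (by omega), if_neg (by omega), map_zero]

theorem map_evalAt_patch_h (u : Smooth) (β : ℂ) (c : ℕ → ℂ) (g : ℕ) (x : ℝ) :
    map (Smooth.evalAt x : Smooth →+* ℂ)
        (patch g (KdV.fSeries (potMinus u) c) (expSmooth u β I))
      = revSeries g (H u.1 β c g x) := by
  ext j
  rw [coeff_map, H, coeff_revSeries_zPoly]
  split_ifs with hj
  · exact congrFun (coe_coeff_patch_h u β c g hj) x
  · rw [coeff_patch, if_neg (by omega), if_neg (by omega), map_zero]

/-- Reversal is applied to zG rather than to G: the bound `g - 1` for G has no meaning at `g = 0`.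
-/
theorem natDegree_X_mul_zPoly_le (g : ℕ) (a : ℕ → ℂ) :
    (Polynomial.X * zPoly g a).natDegree ≤ g := by
  cases g with
  | zero => simp [zPoly]
  | succ g =>
    rw [add_comm g 1]
    exact Polynomial.natDegree_mul_le_of_le Polynomial.natDegree_X_le
      (add_comm 1 g ▸ natDegree_zPoly_le g a)

theorem coeff_revSeries_X_mul_zPoly (g : ℕ) (a : ℕ → ℂ) (k : ℕ) :
    coeff k (revSeries g (Polynomial.X * zPoly g a)) = if k < g then a k else 0 := by
  cases g with
  | zero => simp [zPoly, revSeries]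
  | succ g =>
    have h := revSeries_X_pow_mul (m := 1) (natDegree_zPoly_le g a)
    rw [pow_one, add_comm 1 g] at h
    rw [h, coeff_revSeries_zPoly]
    simp only [Nat.lt_succ_iff]

theorem map_evalAt_patch_g {u : Smooth} {α : ℂ} {c : ℕ → ℂ} {g : ℕ} {G' : Smooth⟦X⟧}
    (hsol : IsSgSolution Smooth.der (Smooth.der u) (KdV.fSeries (potPlus u) c) G'
      (KdV.fSeries (potMinus u) c)) (x : ℝ) :
    map (Smooth.evalAt x : Smooth →+* ℂ) (patch g G' 0)
      = revSeries g (Polynomial.X * G u.1 α c g x) := by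
  ext j
  rw [coeff_map, G, coeff_revSeries_X_mul_zPoly, coeff_patch, ite_self]
  split_ifs with hj
  · exact congrFun (coe_coeff_g hsol hj) x
  · exact map_zero _

theorem revSeries_R {u : Smooth} {α β : ℂ} {c : ℕ → ℂ} {g : ℕ} {G' : Smooth⟦X⟧}
    (hsol : IsSgSolution Smooth.der (Smooth.der u) (KdV.fSeries (potPlus u) c) G'
      (KdV.fSeries (potMinus u) c)) (x : ℝ) :
    revSeries (2 * g + 1) (R u.1 α β c g x) = map (Smooth.evalAt x : Smooth →+* ℂ)
      (X * patch g G' 0 ^ 2 + patch g (KdV.fSeries (potPlus u) c) (expSmooth u α (-I))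
        * patch g (KdV.fSeries (potMinus u) c) (expSmooth u β I)) := by
  have dF : (F u.1 α c g x).natDegree ≤ g := natDegree_zPoly_le _ _
  have dH : (H u.1 β c g x).natDegree ≤ g := natDegree_zPoly_le _ _
  have dG : (Polynomial.X * G u.1 α c g x).natDegree ≤ g := natDegree_X_mul_zPoly_le _ _
  have hR : R u.1 α β c g x = Polynomial.X * G u.1 α c g x * (Polynomial.X * G u.1 α c g x)
      + Polynomial.X ^ 1 * (F u.1 α c g x * H u.1 β c g x) := by
    rw [R]; ring
  rw [hR, show 2 * g + 1 = 1 + (g + g) by ring, revSeries_add,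
    revSeries_of_natDegree_le (Polynomial.natDegree_mul_le_of_le dG dG),
    revSeries_X_pow_mul (Polynomial.natDegree_mul_le_of_le dF dH), revSeries_mul dG dG,
    revSeries_mul dF dH, map_add, map_mul, map_mul, map_pow, map_X, map_evalAt_patch_f,
    map_evalAt_patch_h, map_evalAt_patch_g (α := α) hsol]
  ring

theorem hat_formula {g : ℕ} {c : ℕ → ℂ} {α β : ℂ} {u : Smooth} {E : Fin (2 * g + 1) → ℂ} {x₀ : ℝ}
    (hst : IsStationary u.1 α β c g) (hR : R u.1 α β c g x₀ = rootPoly E) (x : ℝ) :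
    (∀ μ : Fin g → ℂ, F u.1 α c g x = rootPoly μ →
      (∀ j : ℕ, j < g → fHat u.1 α g j x =
        ∑ k ∈ Finset.range (j + 1), cCoeff (j - k) E * Psi k μ) ∧
      fHat u.1 α g g x = Psi g μ) ∧
    (∀ ν : Fin g → ℂ, H u.1 β c g x = rootPoly ν →
      (∀ j : ℕ, j < g → hHat u.1 β g j x =
        ∑ k ∈ Finset.range (j + 1), cCoeff (j - k) E * Psi k ν) ∧
      hHat u.1 β g g x = Psi g ν) := by
  obtain ⟨G', hsol⟩ := exists_isSgSolution u c
  have hpatch := patch_isSgSolution hsol (stationary_smooth hsol hst)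
  have hr := Smooth.eq_map_of_coeffDeriv_eq_zero hpatch.coeffDeriv_form x₀
  rw [← revSeries_R hsol, hR, revSeries_rootPoly] at hr
  have hf := hpatch.kdvForm_f
  have hh := hpatch.kdvForm_h
  rw [hr] at hf hh
  refine ⟨fun μ hF => ?_, fun ν hH => ?_⟩
  · have hev := map_evalAt_patch_f u α c g x
    rw [hF, revSeries_rootPoly] at hev
    refine ⟨fun j hj => ?_, ?_⟩
    -- Here `j < g` forces `g > 0`, so the leading coefficient is the KdV one and not the
    -- exponential.
    · have h0 : constantCoeff (patch g (KdV.fSeries (potPlus u) c) (expSmooth u α (-I))) = 1 := by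
        rw [← coeff_zero_eq_constantCoeff_apply, coeff_patch, if_pos (by omega),
          coeff_zero_eq_constantCoeff_apply, KdV.constantCoeff_fSeries]
      have := KdV.fAt_zero_eq (W := potPlus u) h0 hf j x
      rw [hev, coeff_cSeries_mul_rootSeries, coe_potPlus] at this
      rw [fHat, fAt, if_neg hj.ne, this]
    -- The top coefficient does not involve the integration constants; it is simply the constant
    -- term in z of F, which is Ψ_g.
    · have := congrFun (coe_coeff_patch_f u α c g le_rfl) x
      rw [← coeff_rootSeries, ← hev, coeff_map, fHat, fAt, if_pos rfl]
      rw [fAt, if_pos rfl] at this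
      exact this.symm
  · have hev := map_evalAt_patch_h u β c g x
    rw [hH, revSeries_rootPoly] at hev
    refine ⟨fun j hj => ?_, ?_⟩
    · have h0 : constantCoeff (patch g (KdV.fSeries (potMinus u) c) (expSmooth u β I)) = 1 := by
        rw [← coeff_zero_eq_constantCoeff_apply, coeff_patch, if_pos (by omega),
          coeff_zero_eq_constantCoeff_apply, KdV.constantCoeff_fSeries]
      have := KdV.fAt_zero_eq (W := potMinus u) h0 hh j x
      rw [hev, coeff_cSeries_mul_rootSeries, coe_potMinus] at this
      rw [hHat, hAt, if_neg hj.ne, this]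
    · have := congrFun (coe_coeff_patch_h u β c g le_rfl) x
      rw [← coeff_rootSeries, ← hev, coeff_map, hHat, hAt, if_pos rfl]
      rw [hAt, if_pos rfl] at this
      exact this.symm

end SGmKdV

end

end Soliton

end

theorem mainTheorem5 :
    -- KdV
    (∀ (g : ℕ) (c : ℕ → ℂ) (V : ℝ → ℂ) (E : Fin (2 * g + 1) → ℂ) (x₀ : ℝ),
      ContDiff ℝ ∞ V →
      Soliton.KdV.IsStationary V c g →
      Soliton.KdV.R V c g x₀ = Soliton.rootPoly E →
      ∀ (x : ℝ) (μ : Fin g → ℂ),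
        Soliton.KdV.F V c g x = Soliton.rootPoly μ →
        ∀ j : ℕ, Soliton.KdV.fHat V j x =
          ∑ k ∈ Finset.range (min j g + 1), Soliton.cCoeff (j - k) E * Soliton.Psi k μ) ∧
    -- Toda
    (∀ (g : ℕ) (c : ℕ → ℂ) (a b : ℤ → ℂ) (E : Fin (2 * g + 2) → ℂ) (n₀ : ℤ),
      Soliton.Toda.IsStationary a b c g →
      Soliton.Toda.R a b c g n₀ = Soliton.rootPoly E →
      ∀ (n : ℤ) (μ : Fin g → ℂ),
        Soliton.Toda.F a b c g n = Soliton.rootPoly μ →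
        ∀ j : ℕ, Soliton.Toda.fHat a b j n =
          ∑ k ∈ Finset.range (min j g + 1), Soliton.cCoeff (j - k) E * Soliton.Psi k μ) ∧
    -- AKNS
    (∀ (g : ℕ) (c : ℕ → ℂ) (p q : ℝ → ℂ) (E : Fin (2 * g + 2) → ℂ) (x₀ : ℝ),
      ContDiff ℝ ∞ p → ContDiff ℝ ∞ q →
      Soliton.AKNS.IsStationary p q c g →
      Soliton.AKNS.R p q c g x₀ = Soliton.rootPoly E →
      ∀ x : ℝ,
        (∀ μ : Fin g → ℂ,
          Soliton.AKNS.F p q c g x =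
            Polynomial.C (-Complex.I * q x) * Soliton.rootPoly μ →
          ∀ j : ℕ, Soliton.AKNS.fHat p q j x =
            -Complex.I * q x *
              ∑ k ∈ Finset.range (min j g + 1), Soliton.cCoeff (j - k) E * Soliton.Psi k μ) ∧
        (∀ ν : Fin g → ℂ,
          Soliton.AKNS.H p q c g x =
            Polynomial.C (Complex.I * p x) * Soliton.rootPoly ν →
          ∀ j : ℕ, Soliton.AKNS.hHat p q j x =
            Complex.I * p x *
              ∑ k ∈ Finset.range (min j g + 1), Soliton.cCoeff (j - k) E * Soliton.Psi k ν)) ∧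
    -- sGmKdV
    (∀ (g : ℕ) (c : ℕ → ℂ) (α β : ℂ) (u : ℝ → ℂ) (E : Fin (2 * g + 1) → ℂ) (x₀ : ℝ),
      ContDiff ℝ ∞ u →
      Soliton.SGmKdV.IsStationary u α β c g →
      Soliton.SGmKdV.R u α β c g x₀ = Soliton.rootPoly E →
      ∀ x : ℝ,
        (∀ μ : Fin g → ℂ,
          Soliton.SGmKdV.F u α c g x = Soliton.rootPoly μ →
          (∀ j : ℕ, j < g → Soliton.SGmKdV.fHat u α g j x =
            ∑ k ∈ Finset.range (j + 1), Soliton.cCoeff (j - k) E * Soliton.Psi k μ) ∧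
          Soliton.SGmKdV.fHat u α g g x = Soliton.Psi g μ) ∧
        (∀ ν : Fin g → ℂ,
          Soliton.SGmKdV.H u β c g x = Soliton.rootPoly ν →
          (∀ j : ℕ, j < g → Soliton.SGmKdV.hHat u β g j x =
            ∑ k ∈ Finset.range (j + 1), Soliton.cCoeff (j - k) E * Soliton.Psi k ν) ∧
          Soliton.SGmKdV.hHat u β g g x = Soliton.Psi g ν)) := by
  refine ⟨fun g c V E x₀ hV hst hR x μ hF j => ?_, fun g c a b E n₀ hst hR n μ hF j => ?_,
    fun g c p q E x₀ hp hq hst hR x => ?_, fun g c α β u E x₀ hu hst hR x => ?_⟩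
  · exact Soliton.KdV.hat_formula g c ⟨V, hV⟩ E x₀ hst hR x μ hF j
  · exact Soliton.Toda.hat_formula hst hR n μ hF j
  · exact Soliton.AKNS.hat_formula (p := ⟨p, hp⟩) (q := ⟨q, hq⟩) hst hR x
  · exact Soliton.SGmKdV.hat_formula (u := ⟨u, hu⟩) hst hR x
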